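/- **Setting.** Give $\mathbb R^n$ the $\ell^\infty$ distance $d$. A quantum lattice system is a set $\Lambda\subset\mathbb R^n$ of sites, with at most $C(d+1)^n$ sites in any hypercube of diameter $d$, and a non-zero finite-dimensional Hilbert space $V_j$ for each $j\in\Lambda$. For bounded $X$ let $\mathscr A(X)=\bigotimes_{j\in X\cap\Lambda}\mathrm{End}(V_j)$, and let $\mathscr A$ be the quasi-local $C^*$-algebra, the norm completion of $\varinjlim\mathscr A(X)$. A brick is a non-empty set $Y=\prod_i[\ell_i,m_i]$ with integers $\ell_i\le m_i$; $\mathfrak d_l^Y$ is the space of traceless anti-hermitian elements of $\mathscr A(Y)$ all of whose partial traces onto $\mathscr A(X)$, $X\subsetneq Y$ a brick, vanish. For non-empty $U\subset\mathbb R^n$, $\mathfrak D_{al}(U)$ is the space of families $\mathsf F=(\mathsf F^Y)_Y$, $\mathsf F^Y\in\mathfrak d_l^Y$, with $\sup_Y\|\mathsf F^Y\|(1+\mathrm{diam}\,Y+d(U,Y))^k<\infty$ for all $k\ge 0$; the bracket is $[\mathsf F,\mathsf G]^Z=\sum_{X,Y}[\mathsf F^X,\mathsf G^Y]^Z$. Elements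 of $\mathfrak D_{al}(\{0\})$ are called inner; a state $\psi$ of $\mathscr A$ is evaluated on them by $\psi(\mathsf F)=\psi(\sum_Y\mathsf F^Y)$. Let $\psi$ be any state of $\mathscr A$, and let $\mathfrak D^\psi_{al}(U)$ be the set of $\mathsf F\in\mathfrak D_{al}(U)$ with $\psi([\mathsf F,a])=0$ for all $a\in\mathfrak D_{al}(\{0\})$. Let $\mathcal{CS}_n$ be the set of non-empty closed semilinear subsets of $\mathbb R^n$, pre-ordered by fuzzy inclusion: $U\le V$ iff $U$ lies in $V^r=\{x: d(x,V)\le r\}$ for some $r\ge0$. It has meets $\wedge$. Let $W\in\mathcal{CS}_n$ and let $\mathfrak U=\{U_i\}_{i\in I}$ be a finite cover of $W$, $I$ linearly ordered, i.e. $U_i\le W$ for all $i$ and $W\subseteq(\bigcup_iU_i)^r$ for some $r$. For $U\in\mathcal{CS}_n$ let $\hat U\subset S^{n-1}=(\mathbb R^n\setminus 0)/\mathbb R_{>0}$ be the set of directions whose half-line from the origin is fuzzily included in $U$. A spherical CS cocycle of degree $p\ge 0$ is a real simplicial $p$-cocycle $\beta$ of the Čech nerve of $\{\hat U_i\}_{i\in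 I}$ (whose simplices are the non-empty $s\subseteq I$ with $\bigcap_{i\in s}\hat U_i\ne\varnothing$); put $\beta_s=0$ if $s$ is not a simplex of the nerve. Let $A=\prod_{k\in\mathbb Z}A_k$ be a supercommutative associative graded real algebra (not necessarily unital) with finite-dimensional components. The 1-shifted augmented Čech complex $\mathfrak M=C^{aug}_{\bullet+1}(\mathfrak U,W;\mathfrak D^\psi_{al}\otimes A)$ has elements $f=\sum_{s\subseteq I}e_s\otimes f_s$ with $f_s\in\mathfrak D^\psi_{al}(\bigwedge_{i\in s}U_i)\otimes A$ (the meet being $W$ for $s=\varnothing$), where $e_s=e_{i_0}\wedge\dots\wedge e_{i_q}$ for $s=\{i_0<\dots<i_q\}$. The component of $f_s$ in $\mathfrak D^\psi_{al}\otimes A_k$ has degree $|s|+k$. The differential $\partial$ is the contraction $e_i\mapsto1$, and $[e_s\otimes\mathsf F\otimes a,\,e_t\otimes\mathsf G\otimes b]=(-1)^{|a||t|}\,e_s\wedge e_t\otimes[\mathsf F,\mathsf G]\otimes ab$. The commutator DGLA $[\mathfrak M,\mathfrak M]$ consists of the elements whose component in every degree is a finite linear combination of commutators of homogeneous elements of $\mathfrak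 M$. For a cochain $\beta$ of degree $p$ put $\langle f,\beta\rangle=\sum_{|s|=p+1}\beta_sf_s$. **Statement.** Let $f\in[\mathfrak M,\mathfrak M]$ with $\partial f=0$, and let $\beta$ be a spherical CS cocycle of degree $p$. Then $\langle f,\beta\rangle$ is inner, i.e. each of its components in $A_k$ lies in $\mathfrak D_{al}(\{0\})\otimes A_k$, so that $\psi(\langle f,\beta\rangle)\in\prod_k\mathbb C\otimes_{\mathbb R}A_k$ is defined; and it depends only on the cohomology class of $\beta$ and on the homology class of $f$ in $[\mathfrak M,\mathfrak M]$: if $f'\in[\mathfrak M,\mathfrak M]$ is a cycle with $f-f'=\partial g$ for some $g\in[\mathfrak M,\mathfrak M]$, and $\beta'$ is a $p$-cocycle with $\beta-\beta'=\check\delta b$ for a $(p-1)$-cochain $b$ of the nerve ($\beta=\beta'$ if $p=0$), then $$\psi(\langle f,\beta\rangle)=\psi(\langle f',\beta'\rangle).$$ -/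

import Mathlib

open scoped TensorProduct Matrix.Norms.L2Operator

noncomputable section

namespace LatticeGauge

/-! ## Bricks and distances in `ℝⁿ`

`ℝⁿ` is `Fin n → ℝ`, whose Mathlib distance is the `ℓ^∞` distance. -/

/-- Bricks `∏ᵢ [ℓᵢ, mᵢ]` with integers `ℓᵢ ≤ mᵢ`; the order is inclusion. -/
abbrev Brick (n : ℕ) := NonemptyInterval (Fin n → ℤ)

namespace Brick

/-- The brick as a subset of `ℝⁿ`. -/
def toSet {n : ℕ} (Y : Brick n) : Set (Fin n → ℝ) :=
  {x | ∀ i, (Y.fst i : ℝ) ≤ x i ∧ x i ≤ (Y.snd i : ℝ)}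

/-- The (possibly empty) box obtained from `Y` by moving inwards by one unit the faces listed in
`c`; `(i, false)` is the lower and `(i, true)` the upper face in direction `i`. The nonempty ones
with `c` a singleton are the maximal bricks properly contained in `Y`, and
`Y.shrink c` is the intersection of the `Y.shrink {a}`, `a ∈ c` (and of `Y`). -/
def shrink {n : ℕ} (Y : Brick n) (c : Finset (Fin n × Bool)) : Set (Fin n → ℝ) :=
  {x | ∀ i, (Y.fst i : ℝ) + (if (i, false) ∈ c then 1 else 0) ≤ x i ∧
    x i ≤ (Y.snd i : ℝ) - (if (i, true) ∈ c then 1 else 0)}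

end Brick

/-- `d(U, V) = inf d(x, y)` over `x ∈ U`, `y ∈ V` (only used for nonempty sets). -/
def setDist {n : ℕ} (U V : Set (Fin n → ℝ)) : ℝ :=
  ⨅ p : U × V, dist (p.1 : Fin n → ℝ) (p.2 : Fin n → ℝ)

/-! ## Quantum lattice systems -/

/-- A quantum lattice system on `ℝⁿ`: a set of sites with at most `C (d + 1)ⁿ` points in any
hypercube of diameter `d`, and at each site `j` the nonzero finite-dimensional Hilbert space
`V_j = ℂ^(dim j)`. -/
structure LatticeSystem (n : ℕ) where
  sites : Set (Fin n → ℝ)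
  dim : sites → ℕ
  dim_pos : ∀ j, 0 < dim j
  growth : ∃ C : ℝ, 0 < C ∧ ∀ (x : Fin n → ℝ) (d : ℝ), 0 ≤ d →
    (sites ∩ Set.Icc x (fun i => x i + d)).Finite ∧
      ((sites ∩ Set.Icc x (fun i => x i + d)).ncard : ℝ) ≤ C * (d + 1) ^ n

namespace LatticeSystem

variable {n : ℕ} (L : LatticeSystem n)

theorem finite_sites_brick (Y : Brick n) : {j : L.sites | (j : Fin n → ℝ) ∈ Y.toSet}.Finite := by
  obtain ⟨C, -, h⟩ := L.growth
  have h1 := (h (fun i => (Y.fst i : ℝ)) (∑ i, ((Y.snd i : ℝ) - Y.fst i))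
    (Finset.sum_nonneg fun i _ => by
      have := Y.fst_le_snd i
      have : (Y.fst i : ℝ) ≤ Y.snd i := by exact_mod_cast this
      linarith)).1
  refine Set.Finite.of_finite_image (f := Subtype.val) (h1.subset ?_)
    Subtype.val_injective.injOn
  rintro _ ⟨j, hj, rfl⟩
  refine ⟨j.2, fun i => (hj i).1, fun i => (hj i).2.trans ?_⟩
  have hs : ((Y.snd i : ℝ) - Y.fst i) ≤ ∑ i, ((Y.snd i : ℝ) - Y.fst i) :=
    Finset.single_le_sum (f := fun i => ((Y.snd i : ℝ) - Y.fst i)) (fun i _ => by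
      have := Y.fst_le_snd i
      have : (Y.fst i : ℝ) ≤ Y.snd i := by exact_mod_cast this
      linarith) (Finset.mem_univ i)
  show (Y.snd i : ℝ) ≤ Y.fst i + _
  linarith

/-- The finite set of sites in a brick. -/
def brickSites (Y : Brick n) : Finset L.sites := (L.finite_sites_brick Y).toFinset

open scoped Classical in
/-- The sites of the brick `Y` which lie in the box `Y.shrink c`. -/
def shrinkSites (Y : Brick n) (c : Finset (Fin n × Bool)) : Finset L.sites :=
  (L.brickSites Y).filter fun j => (j : Fin n → ℝ) ∈ Y.shrink c

/-- Labels of the product orthonormal basis of `⨂_{j ∈ S} V_j`. -/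
abbrev Conf (S : Finset L.sites) := ∀ j : S, Fin (L.dim j)

/-- The algebra `⨂_{j ∈ S} End(V_j) = End(⨂_{j ∈ S} V_j)` of observables on a finite set of sites,
with the operator norm (written in the product basis). -/
abbrev Loc (S : Finset L.sites) := Matrix (L.Conf S) (L.Conf S) ℂ

variable {L}

open scoped Classical in
/-- The configuration on `S` equal to `σ` on `S ∩ T` and to `ρ` on `S \ T`. -/
def glue {S T : Finset L.sites} (σ : L.Conf T) (ρ : L.Conf S) : L.Conf S := fun j =>
  if h : (j : L.sites) ∈ T then σ ⟨j, h⟩ else ρ j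

open scoped Classical in
/-- The map `Loc S → Loc T` which takes the normalized partial trace over the sites of `S \ T` and
tensors with the identity on the sites of `T \ S`. For `S ⊆ T` it is the inclusion of algebras, for
`T ⊆ S` it is the normalized partial trace. (The average over `ρ : Conf S` below only involves
the values of `ρ` on `S \ T`.) -/
def transfer (S T : Finset L.sites) : L.Loc S →ₗ[ℂ] L.Loc T where
  toFun a := Matrix.of fun σ τ =>
    if ∀ j : T, (j : L.sites) ∉ S → σ j = τ j then
      (Fintype.card (L.Conf S) : ℂ)⁻¹ * ∑ ρ : L.Conf S, a (glue σ ρ) (glue τ ρ)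
    else 0
  map_add' a b := by
    ext σ τ
    simp only [Matrix.add_apply, Matrix.of_apply]
    split_ifs
    · rw [Finset.sum_add_distrib, mul_add]
    · simp
  map_smul' c a := by
    ext σ τ
    simp only [Matrix.smul_apply, Matrix.of_apply, smul_eq_mul, RingHom.id_apply]
    split_ifs
    · rw [← Finset.mul_sum]; ring
    · simp

open scoped Classical in
/-- The commutator of two local observables, an observable on the union of the supports. -/
def comm {S T : Finset L.sites} (a : L.Loc S) (b : L.Loc T) : L.Loc (S ∪ T) :=
  transfer S (S ∪ T) a * transfer T (S ∪ T) b - transfer T (S ∪ T) b * transfer S (S ∪ T) a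

/-- The component `a^Z` of a traceless local observable along a brick `Z`, in the decomposition of
traceless observables into parts intrinsically localized on bricks: writing `E_B` for the
normalized partial trace onto the observables in `B`, it is `E_Z ∏ (1 - E_B) a` with `B` running
over the `2n` boxes `Z.shrink {(i, ±)}`; the product is expanded by `E_B E_B' = E_{B ∩ B'}`. -/
def component {S : Finset L.sites} (Z : Brick n) (a : L.Loc S) : L.Loc (L.brickSites Z) :=
  ∑ c : Finset (Fin n × Bool), (-1 : ℂ) ^ c.card •
    transfer (L.shrinkSites Z c) (L.brickSites Z) (transfer S (L.shrinkSites Z c) a)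

variable (L)

/-- The space `𝔡_l^Y`: traceless anti-hermitian observables on the brick `Y` whose partial traces
onto all bricks properly contained in `Y` vanish. -/
def brickPart (Y : Brick n) : Set (L.Loc (L.brickSites Y)) :=
  {a | a.conjTranspose = -a ∧ a.trace = 0 ∧
    ∀ X : Brick n, X < Y → transfer (L.brickSites Y) (L.brickSites X) a = 0}

/-- Families `{F^Y}` of observables indexed by bricks: the ambient space of all derivations. -/
abbrev Family := ∀ Y : Brick n, L.Loc (L.brickSites Y)

/-- `𝔇_al(U)` for a nonempty `U`: the families with `F^Y ∈ 𝔡_l^Y` all of whose norms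
`sup_Y ‖F^Y‖ (1 + diam Y + d(U, Y))^k` are finite. -/
def Dal (U : Set (Fin n → ℝ)) : Set L.Family :=
  {F | (∀ Y, F Y ∈ L.brickPart Y) ∧
    ∀ k : ℕ, ∃ C : ℝ, ∀ Y, ‖F Y‖ * (1 + Metric.diam Y.toSet + setDist U Y.toSet) ^ k ≤ C}

variable {L}

/-- The Lie bracket `[F, G]^Z = ∑_{X, Y} [F^X, G^Y]^Z`. -/
def bracket (F G : L.Family) : L.Family := fun Z =>
  ∑' p : Brick n × Brick n, component Z (comm (F p.1) (G p.2))

variable (L)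

/-! ## The quasi-local algebra and states

The algebras `Loc S` act compatibly, isometrically and by `*`-homomorphisms on the Hilbert space with
orthonormal basis all configurations on the whole lattice; the quasi-local algebra (the norm
completion of the union of the `Loc S`) is realized as the norm closure of their union there. -/

/-- Configurations on the whole lattice. -/
abbrev GlobalConf := ∀ j : L.sites, Fin (L.dim j)

/-- The Hilbert space with orthonormal basis the set of all configurations. -/
abbrev Hilb := lp (fun _ : L.GlobalConf => ℂ) 2

variable {L}

/-- The restriction of a configuration to `S`. -/
def resConf (S : Finset L.sites) (σ : L.GlobalConf) : L.Conf S := fun j => σ j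

open scoped Classical in
/-- Replace a configuration by `β` on `S`. -/
def updConf {S : Finset L.sites} (β : L.Conf S) (σ : L.GlobalConf) : L.GlobalConf := fun j =>
  if h : j ∈ S then β ⟨j, h⟩ else σ j

theorem eq_of_updConf {S : Finset L.sites} {β : L.Conf S} {σ τ : L.GlobalConf}
    (h : resConf S σ = resConf S τ) (h' : updConf β σ = updConf β τ) : σ = τ := by
  funext j
  by_cases hj : j ∈ S
  · exact congrFun h ⟨j, hj⟩
  · have := congrFun h' j
    simpa [updConf, hj] using this

open scoped Classical in
/-- The matrix unit `|α⟩⟨β|` on `S`, tensored with the identity, applied to a function. -/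
def unitFun {S : Finset L.sites} (α β : L.Conf S) (φ : L.GlobalConf → ℂ) : L.GlobalConf → ℂ :=
  fun σ => if resConf S σ = α then φ (updConf β σ) else 0

theorem sum_unitFun_le {S : Finset L.sites} (α β : L.Conf S) (φ : L.Hilb)
    (s : Finset L.GlobalConf) :
    ∑ σ ∈ s, ‖unitFun α β φ σ‖ ^ (2 : ENNReal).toReal ≤ ‖φ‖ ^ (2 : ENNReal).toReal := by
  classical
  have h2 : 0 < (2 : ENNReal).toReal := by norm_num
  have hinj : Set.InjOn (updConf β) (s.filter fun σ => resConf S σ = α : Finset L.GlobalConf) := by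
    intro σ hσ τ hτ h
    simp only [Finset.coe_filter, Set.mem_ofPred_eq] at hσ hτ
    exact eq_of_updConf (hσ.2.trans hτ.2.symm) h
  calc ∑ σ ∈ s, ‖unitFun α β φ σ‖ ^ (2 : ENNReal).toReal
      = ∑ σ ∈ s.filter (fun σ => resConf S σ = α), ‖φ (updConf β σ)‖ ^ (2 : ENNReal).toReal := by
        rw [Finset.sum_filter]
        refine Finset.sum_congr rfl fun σ _ => ?_
        by_cases h : resConf S σ = α
        · simp [unitFun, h]
        · simp [unitFun, h]
    _ = ∑ τ ∈ (s.filter (fun σ => resConf S σ = α)).image (updConf β),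
          ‖φ τ‖ ^ (2 : ENNReal).toReal :=
        (Finset.sum_image (f := fun τ => ‖φ τ‖ ^ (2 : ENNReal).toReal) hinj).symm
    _ ≤ _ := lp.sum_rpow_le_norm_rpow h2 φ _

/-- The matrix unit `|α⟩⟨β|` on `S`, tensored with the identity, as an operator. -/
def unitOp {S : Finset L.sites} (α β : L.Conf S) : L.Hilb →L[ℂ] L.Hilb :=
  LinearMap.mkContinuous
    { toFun := fun φ => ⟨unitFun α β φ, memℓp_gen' (sum_unitFun_le α β φ)⟩
      map_add' := fun φ χ => by
        ext σ
        simp only [unitFun, lp.coeFn_add, Pi.add_apply]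
        split_ifs <;> simp
      map_smul' := fun c φ => by
        ext σ
        simp only [unitFun, lp.coeFn_smul, Pi.smul_apply, RingHom.id_apply]
        split_ifs <;> simp }
    1 (fun φ => by
      rw [one_mul]
      exact lp.norm_le_of_forall_sum_le (by norm_num) (norm_nonneg _) (sum_unitFun_le α β φ))

/-- The action of `Loc S` on the global Hilbert space,
`(a φ)(σ) = ∑_β a (σ|_S, β) φ (σ with σ|_S replaced by β)`. -/
def rep (S : Finset L.sites) : L.Loc S →ₗ[ℂ] (L.Hilb →L[ℂ] L.Hilb) where
  toFun a := ∑ α, ∑ β, a α β • unitOp α β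
  map_add' a b := by simp [add_smul, Finset.sum_add_distrib]
  map_smul' c a := by simp [mul_smul, Finset.smul_sum]

variable (L)

/-- The quasi-local `C*`-algebra `𝒜`. -/
def quasiLocal : StarSubalgebra ℂ (L.Hilb →L[ℂ] L.Hilb) :=
  (StarAlgebra.adjoin ℂ (⋃ S : Finset L.sites, Set.range (rep S))).topologicalClosure

variable {L}

theorem rep_mem (S : Finset L.sites) (a : L.Loc S) : rep S a ∈ L.quasiLocal :=
  StarSubalgebra.le_topologicalClosure _
    (StarAlgebra.subset_adjoin ℂ _ (Set.mem_iUnion.2 ⟨S, a, rfl⟩))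

/-- A local observable as an element of the quasi-local algebra. -/
def incl (S : Finset L.sites) (a : L.Loc S) : L.quasiLocal := ⟨rep S a, rep_mem S a⟩

variable (L)

/-- States on the quasi-local algebra. -/
structure State where
  toFun : L.quasiLocal →L[ℂ] ℂ
  nonneg : ∀ a, 0 ≤ (toFun (star a * a)).re ∧ (toFun (star a * a)).im = 0
  map_one : toFun 1 = 1

variable {L}

/-- The `ψ`-average of an inner derivation `F`: the value of `ψ` on `∑_Y F^Y ∈ 𝒜`. -/
def average (ψ : L.State) (F : L.Family) : ℂ :=
  ψ.toFun (∑' Y : Brick n, incl (L.brickSites Y) (F Y))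

/-- `𝔇_al^ψ(U)`: the elements `F` of `𝔇_al(U)` with `ψ([F, a]) = 0` for all almost local `a`. (The
almost local observables are complex combinations of `1`, on which `F` vanishes, and of elements of
`𝔇_al({0})`.) -/
def DalPsi (ψ : L.State) (U : Set (Fin n → ℝ)) : Set L.Family :=
  {F | F ∈ L.Dal U ∧ ∀ G ∈ L.Dal {0}, average ψ (bracket F G) = 0}

end LatticeSystem

/-! ## Fuzzy semilinear sets -/

/-- A finite intersection of hyperplanes and open half-spaces. -/
def IsBasicSemilinear {n : ℕ} (B : Set (Fin n → ℝ)) : Prop :=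
  ∃ H K : Finset ((Fin n → ℝ) × ℝ),
    B = {x | (∀ h ∈ H, h.1 ⬝ᵥ x = h.2) ∧ ∀ h ∈ K, h.1 ⬝ᵥ x < h.2}

/-- A finite union of basic semilinear sets. -/
def IsSemilinear {n : ℕ} (U : Set (Fin n → ℝ)) : Prop :=
  ∃ 𝓑 : Set (Set (Fin n → ℝ)), 𝓑.Finite ∧ (∀ B ∈ 𝓑, IsBasicSemilinear B) ∧ U = ⋃₀ 𝓑

/-- Nonempty closed semilinear subsets of `ℝⁿ`. -/
structure CS (n : ℕ) where
  carrier : Set (Fin n → ℝ)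
  nonempty : carrier.Nonempty
  closed : IsClosed carrier
  semilinear : IsSemilinear carrier

/-- Fuzzy inclusion: `U ≤ V` iff `U` lies in some thickening of `V`. -/
instance {n : ℕ} : Preorder (CS n) where
  le U V := ∃ r : ℝ, 0 ≤ r ∧ U.carrier ⊆ Metric.cthickening r V.carrier
  le_refl U := ⟨0, le_rfl, Metric.self_subset_cthickening _⟩
  le_trans U V W := by
    rintro ⟨r, hr, h⟩ ⟨s, hs, h'⟩
    exact ⟨r + s, add_nonneg hr hs, (h.trans (Metric.cthickening_subset_of_subset r h')).trans
      (Metric.cthickening_cthickening_subset hr hs _)⟩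

/-- The part at infinity `Û ⊆ S^{n-1} = (ℝⁿ \ {0}) / ℝ_{>0}` of `U`: the directions whose half-line
(issuing from the origin) is fuzzily included in `U`. -/
def hat {n : ℕ} (U : CS n) : Set (Module.Ray ℝ (Fin n → ℝ)) :=
  {ρ | ∃ (v : Fin n → ℝ) (hv : v ≠ 0), ρ = rayOfNeZero ℝ v hv ∧
    ∃ r : ℝ, 0 ≤ r ∧ {x | ∃ t : ℝ, 0 ≤ t ∧ x = t • v} ⊆ Metric.cthickening r U.carrier}

/-- A cover of `W` indexed by a finite ordered set `I`. -/
structure Cover {n : ℕ} (W : CS n) (I : Type*) [Fintype I] [LinearOrder I] where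
  U : I → CS n
  le : ∀ i, U i ≤ W
  covers : ∃ r : ℝ, 0 ≤ r ∧ W.carrier ⊆ Metric.cthickening r (⋃ i, (U i).carrier)

namespace Cover

variable {n : ℕ} {W : CS n} {I : Type*} [Fintype I] [LinearOrder I] (𝔘 : Cover W I)

/-- `M` is a meet `⋀_{i ∈ s} U_i` (`W`, up to isomorphism, for `s = ∅`), computed among the objects
below `W`; as `U_i ≤ W`, for nonempty `s` it is a meet of the `U_i`, `i ∈ s`, in all of `CS n`. -/
def IsMeet (s : Finset I) (M : CS n) : Prop := IsGLB (insert W (𝔘.U '' s)) M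

/-- `𝔇_al^ψ(⋀_{i ∈ s} U_i)` (`𝔇_al^ψ(W)` for `s = ∅`). Meets in a pre-ordered set are only unique up
to isomorphism; isomorphic objects have the same `𝔇_al^ψ`. -/
def derivations {L : LatticeSystem n} (ψ : L.State) (s : Finset I) : Set L.Family :=
  {F | ∃ M : CS n, 𝔘.IsMeet s M ∧ F ∈ LatticeSystem.DalPsi ψ M.carrier}

/-! ### Čech cochains of the cover `Û` of `Ŵ` -/

/-- `s` is a simplex of the nerve of the cover of `Ŵ` by the sets `Û i`. -/
def InNerve (s : Finset I) : Prop := s.Nonempty ∧ (⋂ i ∈ s, hat (𝔘.U i)).Nonempty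

/-- Real functions on the nerve simplices with `m` vertices, extended by zero; these are the
simplicial cochains of degree `m - 1`. -/
def IsCochain (m : ℕ) (β : Finset I → ℝ) : Prop :=
  ∀ s, β s ≠ 0 → 𝔘.InNerve s ∧ s.card = m

end Cover

section Signs

variable {I : Type*} [LinearOrder I]

/-- The sign `(-1)^k` where `k` is the number of elements of `s` below `i`. -/
def posSign (i : I) (s : Finset I) : ℝ := (-1) ^ (s.filter (· < i)).card

/-- For disjoint `s`, `t`, the sign with `e_s ∧ e_t = shuffleSign s t • e_{s ∪ t}` in the exterior
algebra. -/
def shuffleSign (s t : Finset I) : ℝ := (-1) ^ ((s ×ˢ t).filter fun q => q.2 < q.1).card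

end Signs

namespace Cover

variable {n : ℕ} {W : CS n} {I : Type*} [Fintype I] [LinearOrder I] (𝔘 : Cover W I)

open scoped Classical in
/-- The simplicial coboundary on cochains of the nerve. -/
def coboundary (β : Finset I → ℝ) : Finset I → ℝ := fun s =>
  if 𝔘.InNerve s then ∑ i ∈ s, posSign i s * β (s.erase i) else 0

/-- `β` is a spherical CS cocycle of degree `p` for the cover. -/
def IsCocycle (p : ℕ) (β : Finset I → ℝ) : Prop :=
  𝔘.IsCochain (p + 1) β ∧ 𝔘.coboundary β = 0

/-- `β` and `β'` differ by the coboundary of a cochain of degree `p - 1` (so they are equal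
when `p = 0`). -/
def Cohomologous (p : ℕ) (β β' : Finset I → ℝ) : Prop :=
  ∃ b, 𝔘.IsCochain p b ∧ β - β' = 𝔘.coboundary b

end Cover

/-! ## The differential graded Lie algebra of a cover -/

/-- An associative supercommutative (not necessarily unital) graded real algebra `∏ₖ A k`. -/
structure SuperAlgebra (A : ℤ → Type*) [∀ k, AddCommGroup (A k)] [∀ k, Module ℝ (A k)] where
  mul : ∀ k l, A k →ₗ[ℝ] A l →ₗ[ℝ] A (k + l)
  assoc : ∀ k l m (a : A k) (b : A l) (c : A m),
    (⟨_, mul (k + l) m (mul k l a b) c⟩ : Σ d, A d) = ⟨_, mul k (l + m) a (mul l m b c)⟩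
  supercomm : ∀ k l (a : A k) (b : A l),
    (⟨_, mul k l a b⟩ : Σ d, A d) = ⟨_, ((k * l).negOnePow : ℤ) • mul l k b a⟩

section DGLA

variable {n : ℕ} {L : LatticeSystem n}
variable {A : ℤ → Type*} [∀ k, AddCommGroup (A k)] [∀ k, Module ℝ (A k)]

/-- `𝔛 ⊗ V` inside (families of observables) `⊗ V`, for a space `𝔛` of families. -/
def tensorSpan (𝔛 : Set L.Family) (V : Type*) [AddCommGroup V] [Module ℝ V] :
    Submodule ℝ (L.Family ⊗[ℝ] V) :=
  Submodule.span ℝ {x | ∃ F ∈ 𝔛, ∃ a : V, x = F ⊗ₜ[ℝ] a}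

/-- `ψ ⊗ id` on (inner derivations) `⊗ V` for a finite-dimensional `V`, written in a basis of
`V`; it takes `F ⊗ a` to `ψ(F) ⊗ a`. -/
def averageTensor (ψ : L.State) {V : Type*} [AddCommGroup V] [Module ℝ V] [FiniteDimensional ℝ V]
    (x : L.Family ⊗[ℝ] V) : ℂ ⊗[ℝ] V :=
  ∑ i, LatticeSystem.average ψ (TensorProduct.rid ℝ L.Family
      (LinearMap.lTensor L.Family ((Module.finBasis ℝ V).coord i) x)) ⊗ₜ[ℝ] Module.finBasis ℝ V i

variable (L A) in
/-- Čech chains with coefficients in derivations `⊗ ∏ₖ A k`: `f s k` is the component at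
`s = {i₀ < ⋯ < iₚ}` (`s = ∅` is the augmentation) and of degree `k` in `A`. In terms of exterior
generators `e_i` it is `∑ e_s ⊗ f s k`. In the 1-shifted augmented Čech complex this component has
degree `|s| + k`. -/
abbrev Chain (I : Type*) := Finset I → ∀ k, L.Family ⊗[ℝ] A k

variable {W : CS n} {I : Type*} [Fintype I] [LinearOrder I]

/-- The (augmented) Čech differential. -/
def boundary (f : Chain L A I) : Chain L A I := fun s k =>
  ∑ i ∈ sᶜ, posSign i (insert i s) • f (insert i s) k

/-- The chain with the single component `x` at `s` and in degree `k`. -/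
def singleChain (s : Finset I) (k : ℤ) (x : L.Family ⊗[ℝ] A k) : Chain L A I :=
  Pi.single s (Pi.single k x)

/-- The part of total degree `d` of a chain. -/
def degreePart (d : ℤ) (f : Chain L A I) : Chain L A I := fun s k =>
  if (s.card : ℤ) + k = d then f s k else 0

/-- The graded bracket `[e_s ⊗ F ⊗ a, e_t ⊗ G ⊗ b] = (-1)^{|a| |t|} (e_s ∧ e_t) ⊗ [F, G] ⊗ ab`. -/
def chainBracket (𝔸 : SuperAlgebra A) (s : Finset I) (F : L.Family) {k : ℤ} (a : A k)
    (t : Finset I) (G : L.Family) {l : ℤ} (b : A l) : Chain L A I :=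
  if Disjoint s t then
    singleChain (s ∪ t) (k + l) (((k * (t.card : ℤ)).negOnePow : ℤ) •
      shuffleSign s t • (LatticeSystem.bracket F G ⊗ₜ[ℝ] 𝔸.mul k l a b))
  else 0

/-- The commutators of total degree `d` of homogeneous decomposable elements `e_s ⊗ F ⊗ a`,
`F ∈ 𝔇_al^ψ(⋀_{i ∈ s} U_i)`, of the DGLA `C^aug_{•+1}(𝔘, W; 𝔇_al^ψ ⊗ A)`. -/
def commutators (ψ : L.State) (𝔸 : SuperAlgebra A) (𝔘 : Cover W I) (d : ℤ) : Set (Chain L A I) :=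
  {c | ∃ (s t : Finset I) (k l : ℤ) (F G : L.Family) (a : A k) (b : A l),
    F ∈ 𝔘.derivations ψ s ∧ G ∈ 𝔘.derivations ψ t ∧
    (s.card : ℤ) + k + (t.card + l) = d ∧ c = chainBracket 𝔸 s F a t G b}

/-- The commutator DGLA of `C^aug_{•+1}(𝔘, W; 𝔇_al^ψ ⊗ A)`: in every degree, the linear combinations
of commutators. (As the bracket is bilinear, decomposable elements suffice.) -/
def commutatorDGLA (ψ : L.State) (𝔸 : SuperAlgebra A) (𝔘 : Cover W I) : Set (Chain L A I) :=
  {f | ∀ d : ℤ, degreePart d f ∈ Submodule.span ℝ (commutators ψ 𝔸 𝔘 d)}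

/-- The evaluation `⟨f, β⟩ = ∑_s β_s f_s`, `s = {i₀ < ⋯ < iₚ}`, of a chain on a cochain of
degree `p`, as a family of components of degree `k` in `A`. -/
def evaluation (p : ℕ) (f : Chain L A I) (β : Finset I → ℝ) (k : ℤ) : L.Family ⊗[ℝ] A k :=
  ∑ s ∈ Finset.univ.filter (fun s : Finset I => s.card = p + 1), β s • f s k

end DGLA

end LatticeGauge

end

/-!
Write `⟨f, β⟩` for the pairing of a chain with a cochain, `∂` for the contraction `e_i ↦ 1`, and
`δ` for the coboundary of the full simplex on the index set, which is adjoint to `∂`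
(`sum_smul_contraction`). The coboundary of the nerve agrees with `δ` on the simplices of the
nerve, so both assertions reduce to what happens at index sets `s` outside the nerve.

The geometric input is `exists_norm_le_of_iInter_hat_eq_empty`: if the semilinear sets `U_i`,
`i ∈ s`, have no common direction at infinity, then `‖x‖` is bounded by a multiple of
`1 + max_i d(x, U_i)`. A sequence violating this has a limiting direction, and a limiting
direction of points of a basic semilinear set is a recession direction of it. Hence a family which
is localized on each of these `U_i` is inner (`mem_dal_zero`). Meets enter only through this: a
family localized on `⋀_{i ∈ s} U_i` is localized on each `U_i`.

*The pairing is inner.* Exterior multiplication by `e_i`, with `i` depending on the brick `Y` and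
chosen such that `U_i` is close to `Y`, is a contracting homotopy for `∂` which respects the
localization. So a cycle is `∂h` for a localized chain `h`, and `⟨f, β⟩ = ⟨h, δβ⟩`, where `δβ` is
supported outside the nerve (`Cover.sum_smul_mem_dal_zero`).

*Invariance.* One has `⟨f, β⟩ - ⟨f', β'⟩ = ⟨f, δ_nerve b⟩ + ⟨g, δβ'⟩` and `⟨f, δb⟩ = 0`; therefore
only components of `f` and `g` outside the nerve contribute. These are combinations of brackets
`[F, G]` of derivations which preserve `ψ`, localized on sets without a common direction at
infinity. For such `F` and `G` the triple series `∑_{X, Y, Z} [F^X, G^Y]^Z` converges absolutely,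
so `ψ([F, G]) = ∑_Y ψ([F, G^Y])`, and every term vanishes because `G^Y` is inner
(`Cover.brackets_subset_averageKer`).

The analysis of the bracket rests on three facts about local observables: partial traces and the
representation on the global Hilbert space are contractive (`norm_transfer_le`, `norm_rep_le`),
and `[F^X, G^Y]^Z` vanishes unless `X` meets `Y` and `Z` is within `diam X + diam Y` of a common
point (`exists_linked`). Polynomial weights on bricks then control all sums.
-/

noncomputable section

namespace LatticeGauge

namespace LatticeSystem

variable {n : ℕ} {L : LatticeSystem n}

/-! ### Partial traces -/

instance (S : Finset L.sites) : Nonempty (L.Conf S) := ⟨fun j => ⟨0, L.dim_pos j⟩⟩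

theorem card_conf_ne_zero (S : Finset L.sites) : (Fintype.card (L.Conf S) : ℂ) ≠ 0 :=
  Nat.cast_ne_zero.2 Fintype.card_ne_zero

theorem glue_apply_mem {S T : Finset L.sites} (σ : L.Conf T) (ρ : L.Conf S) (j : S)
    (h : (j : L.sites) ∈ T) : glue σ ρ j = σ ⟨j, h⟩ := by
  simp [glue, h]

theorem glue_apply_notMem {S T : Finset L.sites} (σ : L.Conf T) (ρ : L.Conf S) (j : S)
    (h : (j : L.sites) ∉ T) : glue σ ρ j = ρ j := by
  simp [glue, h]

/-- If `ρ` and `κ` are independent and uniformly distributed, then so is `glue ρ κ`: exchanging the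
common parts of `ρ` and `κ` is an involution of the pairs. -/
theorem sum_sum_glue {S T : Finset L.sites} (h : L.Conf S → ℂ) :
    ∑ ρ : L.Conf T, ∑ κ : L.Conf S, h (glue ρ κ) =
      Fintype.card (L.Conf T) * ∑ κ : L.Conf S, h κ := by
  have e : Function.Involutive (fun p : L.Conf T × L.Conf S => (glue p.2 p.1, glue p.1 p.2)) := by
    rintro ⟨ρ, κ⟩
    refine Prod.ext (funext fun j => ?_) (funext fun j => ?_)
    · by_cases hj : (j : L.sites) ∈ S <;> simp [glue, hj]
    · by_cases hj : (j : L.sites) ∈ T <;> simp [glue, hj]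
  rw [← Fintype.sum_prod_type' (fun (ρ : L.Conf T) (κ : L.Conf S) => h (glue ρ κ))]
  calc ∑ p : L.Conf T × L.Conf S, h (glue p.1 p.2)
      = ∑ p : L.Conf T × L.Conf S, h p.2 :=
        Fintype.sum_equiv e.toPerm (fun p => h (glue p.1 p.2)) (fun p => h p.2) fun p => rfl
    _ = _ := by
        rw [Fintype.sum_prod_type (fun p : L.Conf T × L.Conf S => h p.2)]
        simp

open scoped Classical in
/-- The configuration equal to `σ` on `S ∩ T ∩ R` and to `κ` on the rest of `S`. -/
def glueOn {S R : Finset L.sites} (T : Finset L.sites) (σ : L.Conf R) (κ : L.Conf S) : L.Conf S :=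
  fun j => if h : (j : L.sites) ∈ R ∧ (j : L.sites) ∈ T then σ ⟨j, h.1⟩ else κ j

open scoped Classical in
theorem transfer_apply {S T : Finset L.sites} (a : L.Loc S) (σ τ : L.Conf T) :
    transfer S T a σ τ = if ∀ j : T, (j : L.sites) ∉ S → σ j = τ j then
      (Fintype.card (L.Conf S) : ℂ)⁻¹ * ∑ ρ : L.Conf S, a (glue σ ρ) (glue τ ρ)
    else 0 := rfl

open scoped Classical in
/-- The composite of two partial traces; the right-hand side depends on the intermediate set `T`
only through `S ∩ T ∩ R`. -/
theorem transfer_transfer_apply {S T R : Finset L.sites} (a : L.Loc S) (σ τ : L.Conf R) :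
    transfer T R (transfer S T a) σ τ =
      if ∀ j : R, ¬ ((j : L.sites) ∈ S ∧ (j : L.sites) ∈ T) → σ j = τ j then
        (Fintype.card (L.Conf S) : ℂ)⁻¹ * ∑ κ : L.Conf S, a (glueOn T σ κ) (glueOn T τ κ)
      else 0 := by
  rw [transfer_apply]
  simp only [transfer_apply]
  have key : ∀ ρ : L.Conf T,
      (∀ j : T, (j : L.sites) ∉ S → glue σ ρ j = glue τ ρ j) ↔
        ∀ j : R, (j : L.sites) ∈ T → (j : L.sites) ∉ S → σ j = τ j := by
    intro ρ
    constructor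
    · intro h j hT hS
      simpa only [glue_apply_mem _ _ (⟨j, hT⟩ : T) j.2] using h ⟨j, hT⟩ hS
    · intro h j hS
      by_cases hR : (j : L.sites) ∈ R
      · rw [glue_apply_mem _ _ _ hR, glue_apply_mem _ _ _ hR]
        exact h ⟨j, hR⟩ j.2 hS
      · rw [glue_apply_notMem _ _ _ hR, glue_apply_notMem _ _ _ hR]
  simp only [key]
  have hg : ∀ (υ : L.Conf R) (ρ : L.Conf T) (κ : L.Conf S),
      glue (glue υ ρ) κ = glueOn T υ (glue ρ κ) := by
    intro υ ρ κ
    funext j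
    by_cases hT : (j : L.sites) ∈ T <;> by_cases hR : (j : L.sites) ∈ R <;>
      simp [glue, glueOn, hT, hR]
  by_cases h1 : ∀ j : R, (j : L.sites) ∉ T → σ j = τ j
  · by_cases h2 : ∀ j : R, (j : L.sites) ∈ T → (j : L.sites) ∉ S → σ j = τ j
    · rw [if_pos h1, if_pos]
      · simp only [if_pos h2, hg]
        rw [← Finset.mul_sum,
          sum_sum_glue (fun κ : L.Conf S => a (glueOn T σ κ) (glueOn T τ κ))]
        rw [mul_left_comm, inv_mul_cancel_left₀ (card_conf_ne_zero T)]
      · intro j hj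
        by_cases hT : (j : L.sites) ∈ T
        · exact h2 j hT fun hS => hj ⟨hS, hT⟩
        · exact h1 j hT
    · rw [if_pos h1, if_neg]
      · simp only [if_neg h2, Finset.sum_const_zero, mul_zero]
      · exact fun h => h2 fun j hT hS => h j fun h' => hS h'.1
  · rw [if_neg h1, if_neg]
    exact fun h => h1 fun j hT => h j fun h' => hT h'.2

theorem transfer_transfer_congr {S T T' R : Finset L.sites} (a : L.Loc S)
    (h : ∀ j ∈ S, j ∈ R → (j ∈ T ↔ j ∈ T')) :
    transfer T R (transfer S T a) = transfer T' R (transfer S T' a) := by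
  classical
  ext σ τ
  rw [transfer_transfer_apply, transfer_transfer_apply]
  have hg : ∀ (υ : L.Conf R) (κ : L.Conf S), glueOn T υ κ = glueOn T' υ κ := by
    intro υ κ
    funext j
    by_cases hR : (j : L.sites) ∈ R
    · simp [glueOn, hR, h j j.2 hR]
    · simp [glueOn, hR]
  have hc : (∀ j : R, ¬ ((j : L.sites) ∈ S ∧ (j : L.sites) ∈ T) → σ j = τ j) ↔
      ∀ j : R, ¬ ((j : L.sites) ∈ S ∧ (j : L.sites) ∈ T') → σ j = τ j := by
    refine forall_congr' fun j => ?_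
    by_cases hS : (j : L.sites) ∈ S
    · rw [h j hS j.2]
    · simp [hS]
  simp only [hg, hc]

theorem transfer_self {S : Finset L.sites} (a : L.Loc S) : transfer S S a = a := by
  classical
  ext σ τ
  have hg : ∀ υ ρ : L.Conf S, glue υ ρ = υ := fun υ ρ => funext fun j =>
    glue_apply_mem υ ρ j j.2
  rw [transfer_apply, if_pos fun j hj => absurd j.2 hj]
  simp only [hg, Finset.sum_const, Finset.card_univ, nsmul_eq_mul]
  rw [inv_mul_cancel_left₀ (card_conf_ne_zero S)]

theorem transfer_transfer {S T R : Finset L.sites} (a : L.Loc S)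
    (h : ∀ j ∈ S, j ∈ R → j ∈ T) :
    transfer T R (transfer S T a) = transfer S R a := by
  rw [transfer_transfer_congr a (T' := S) fun j hS hR => by simp [hS, h j hS hR], transfer_self]

theorem transfer_conjTranspose {S T : Finset L.sites} (a : L.Loc S) :
    (transfer S T a).conjTranspose = transfer S T a.conjTranspose := by
  classical
  ext σ τ
  simp only [Matrix.conjTranspose_apply, transfer_apply, eq_comm (a := τ _)]
  split_ifs
  · simp
  · simp

/-- Partial traces preserve the normalized trace. -/
theorem trace_transfer {S T : Finset L.sites} (a : L.Loc S) :
    (transfer S T a).trace =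
      Fintype.card (L.Conf T) * (Fintype.card (L.Conf S) : ℂ)⁻¹ * a.trace := by
  classical
  simp only [Matrix.trace, Matrix.diag, transfer_apply, implies_true, if_true]
  rw [← Finset.mul_sum, sum_sum_glue (fun κ : L.Conf S => a κ κ)]
  ring

/-- Passing to a submatrix of `A ⊗ 1` does not increase the operator norm. -/
theorem norm_of_ite_le {ι κ E : Type*} [Fintype ι] [Fintype κ] [Fintype E] [DecidableEq ι]
    [DecidableEq κ] [DecidableEq E] (A : Matrix κ κ ℂ) (g : ι → κ) (η : ι → E)
    (hinj : Function.Injective fun i => (g i, η i)) :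
    ‖(Matrix.of fun i j => if η i = η j then A (g i) (g j) else 0 : Matrix ι ι ℂ)‖ ≤ ‖A‖ := by
  let D : Matrix κ κ ℂ →⋆ₙₐ[ℂ] Matrix (κ × E) (κ × E) ℂ :=
    { toFun := fun M => Matrix.blockDiagonal fun _ => M
      map_smul' := fun c M => by
        exact Matrix.blockDiagonal_smul c (fun _ : E => M)
      map_zero' := Matrix.blockDiagonal_zero
      map_add' := fun M N => Matrix.blockDiagonal_add (fun _ : E => M) fun _ => N
      map_mul' := fun M N => Matrix.blockDiagonal_mul (fun _ : E => M) fun _ => N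
      map_star' := fun M => (Matrix.blockDiagonal_conjTranspose fun _ : E => M).symm }
  let j : ι → κ × E := fun i => (g i, η i)
  let V : Matrix (κ × E) ι ℂ := (1 : Matrix (κ × E) (κ × E) ℂ).submatrix id j
  have hVM : ∀ M : Matrix (κ × E) (κ × E) ℂ, V.conjTranspose * M * V = M.submatrix j j := by
    intro M
    rw [Matrix.conjTranspose_submatrix, Matrix.conjTranspose_one]
    ext a b
    simp [V, Matrix.mul_apply, Matrix.one_apply]
  have hV : V.conjTranspose * V = 1 := by
    have := hVM 1
    rwa [Matrix.mul_one, Matrix.submatrix_one j hinj] at this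
  have hV1 : ‖V‖ ≤ 1 := by
    have := Matrix.l2_opNorm_conjTranspose_mul_self V
    rw [hV] at this
    have h1 : ‖(1 : Matrix ι ι ℂ)‖ ≤ 1 := by
      have := CStarRing.norm_self_mul_star (x := (1 : Matrix ι ι ℂ))
      simp at this
      nlinarith [norm_nonneg (1 : Matrix ι ι ℂ)]
    nlinarith [norm_nonneg V]
  have hB : (Matrix.of fun i j => if η i = η j then A (g i) (g j) else 0 : Matrix ι ι ℂ) =
      V.conjTranspose * D A * V := by
    rw [hVM]
    ext a b
    simp [D, j, Matrix.blockDiagonal_apply]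
  rw [hB]
  calc _ ≤ ‖V.conjTranspose‖ * ‖D A‖ * ‖V‖ :=
        (Matrix.l2_opNorm_mul _ _).trans
          (mul_le_mul_of_nonneg_right (Matrix.l2_opNorm_mul _ _) (norm_nonneg _))
    _ ≤ 1 * ‖A‖ * 1 := by
        rw [Matrix.l2_opNorm_conjTranspose]
        gcongr
        exact NonUnitalStarAlgHom.norm_apply_le D A
    _ = ‖A‖ := by ring

/-- Partial traces are contractive. -/
theorem norm_transfer_le {S T : Finset L.sites} (a : L.Loc S) : ‖transfer S T a‖ ≤ ‖a‖ := by
  classical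
  let E := ∀ j : {j : T // (j : L.sites) ∉ S}, Fin (L.dim j)
  let η : L.Conf T → E := fun σ j => σ j
  let B : L.Conf S → L.Loc T := fun ρ =>
    Matrix.of fun σ τ => if η σ = η τ then a (glue σ ρ) (glue τ ρ) else 0
  have hB : ∀ ρ, ‖B ρ‖ ≤ ‖a‖ := fun ρ => by
    refine norm_of_ite_le a (fun σ : L.Conf T => glue σ ρ) η ?_
    intro σ τ h
    funext j
    by_cases hj : (j : L.sites) ∈ S
    · have := congrFun (congrArg Prod.fst h) ⟨j, hj⟩
      simpa only [glue_apply_mem _ _ (⟨j, hj⟩ : S) j.2] using this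
    · exact congrFun (congrArg Prod.snd h) ⟨j, hj⟩
  have h : transfer S T a = (Fintype.card (L.Conf S) : ℂ)⁻¹ • ∑ ρ, B ρ := by
    ext σ τ
    have hη : (∀ j : T, (j : L.sites) ∉ S → σ j = τ j) ↔ η σ = η τ := by
      rw [funext_iff]
      exact ⟨fun h x => h x x.2, fun h j hj => h ⟨j, hj⟩⟩
    rw [transfer_apply, Matrix.smul_apply, Matrix.sum_apply]
    simp only [hη, B, Matrix.of_apply]
    split_ifs <;> simp
  rw [h, norm_smul, norm_inv, Complex.norm_natCast]
  have hc : (0 : ℝ) < Fintype.card (L.Conf S) := Nat.cast_pos.2 Fintype.card_pos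
  rw [inv_mul_le_iff₀ hc]
  calc _ ≤ ∑ ρ : L.Conf S, ‖B ρ‖ := norm_sum_le _ _
    _ ≤ ∑ ρ : L.Conf S, ‖a‖ := Finset.sum_le_sum fun ρ _ => hB ρ
    _ = _ := by simp

/-! ### Commutators and brick components of local observables -/

theorem comm_zero_right {S T : Finset L.sites} (a : L.Loc S) : comm a (0 : L.Loc T) = 0 := by
  simp [comm]

open scoped Classical in
theorem norm_comm_le {S T : Finset L.sites} (a : L.Loc S) (b : L.Loc T) :
    ‖comm a b‖ ≤ 2 * (‖a‖ * ‖b‖) := by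
  have h : ∀ x y : L.Loc (S ∪ T), ‖x‖ ≤ ‖a‖ → ‖y‖ ≤ ‖b‖ → ‖x * y - y * x‖ ≤ 2 * (‖a‖ * ‖b‖) := by
    intro x y hx hy
    have h1 := norm_mul_le x y
    have h2 := norm_mul_le y x
    have h3 : ‖x‖ * ‖y‖ ≤ ‖a‖ * ‖b‖ :=
      mul_le_mul hx hy (norm_nonneg _) (norm_nonneg _)
    have h4 := norm_sub_le (x * y) (y * x)
    nlinarith
  exact h _ _ (norm_transfer_le a) (norm_transfer_le b)

theorem comm_conjTranspose {S T : Finset L.sites} {a : L.Loc S} {b : L.Loc T}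
    (ha : a.conjTranspose = -a) (hb : b.conjTranspose = -b) :
    (comm a b).conjTranspose = -comm a b := by
  classical
  rw [comm, Matrix.conjTranspose_sub, Matrix.conjTranspose_mul, Matrix.conjTranspose_mul,
    transfer_conjTranspose, transfer_conjTranspose, ha, hb, map_neg, map_neg]
  simp

theorem trace_comm {S T : Finset L.sites} (a : L.Loc S) (b : L.Loc T) : (comm a b).trace = 0 := by
  rw [comm, Matrix.trace_sub, Matrix.trace_mul_comm, sub_self]

open scoped Classical in
theorem transfer_apply_of_subset {S T : Finset L.sites} (h : S ⊆ T) (a : L.Loc S)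
    (σ τ : L.Conf T) :
    transfer S T a σ τ = if ∀ j : T, (j : L.sites) ∉ S → σ j = τ j then
      a (fun j : S => σ ⟨j, h j.2⟩) (fun j : S => τ ⟨j, h j.2⟩) else 0 := by
  have hg : ∀ (υ : L.Conf T) (ρ : L.Conf S), glue υ ρ = fun j : S => υ ⟨j, h j.2⟩ := fun υ ρ =>
    funext fun j => glue_apply_mem υ ρ j (h j.2)
  rw [transfer_apply]
  simp only [hg, Finset.sum_const, Finset.card_univ, nsmul_eq_mul]
  rw [inv_mul_cancel_left₀ (card_conf_ne_zero S)]

/-- Observables with disjoint supports commute. -/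
theorem comm_eq_zero {S T : Finset L.sites} (h : Disjoint S T) (a : L.Loc S) (b : L.Loc T) :
    comm a b = 0 := by
  classical
  have hST : ∀ j : L.sites, j ∈ S → j ∉ T := fun j => fun hj => Finset.disjoint_left.1 h hj
  rw [comm, sub_eq_zero]
  ext σ τ
  rw [Matrix.mul_apply, Matrix.mul_apply]
  -- each matrix product has a single intermediate configuration, `μ` or `ν`
  let μ : L.Conf (S ∪ T) := fun j => if (j : L.sites) ∈ S then τ j else σ j
  let ν : L.Conf (S ∪ T) := fun j => if (j : L.sites) ∈ S then σ j else τ j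
  rw [Finset.sum_eq_single μ, Finset.sum_eq_single ν]
  · simp only [transfer_apply_of_subset Finset.subset_union_left,
      transfer_apply_of_subset Finset.subset_union_right]
    have e1 : ∀ j : (S ∪ T : Finset L.sites), (j : L.sites) ∉ S → σ j = μ j := fun j hj => by
      simp [μ, hj]
    have e2 : ∀ j : (S ∪ T : Finset L.sites), (j : L.sites) ∉ S → ν j = τ j := fun j hj => by
      simp [ν, hj]
    have hT : ∀ j : (S ∪ T : Finset L.sites), (j : L.sites) ∉ T → (j : L.sites) ∈ S := fun j hj =>
      (Finset.mem_union.1 j.2).resolve_right hj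
    have e3 : ∀ j : (S ∪ T : Finset L.sites), (j : L.sites) ∉ T → μ j = τ j := fun j hj => by
      simp [μ, hT j hj]
    have e4 : ∀ j : (S ∪ T : Finset L.sites), (j : L.sites) ∉ T → σ j = ν j := fun j hj => by
      simp [ν, hT j hj]
    rw [if_pos e1, if_pos e2, if_pos e3, if_pos e4, mul_comm]
    congr 2
    · funext j
      simp [μ, show (j : L.sites) ∉ S from fun h' => hST j h' j.2]
    · funext j
      simp [ν, show (j : L.sites) ∉ S from fun h' => hST j h' j.2]
    · funext j
      simp [ν]
    · funext j
      simp [μ]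
  · intro κ _ hκ
    rw [transfer_apply_of_subset Finset.subset_union_left,
      transfer_apply_of_subset Finset.subset_union_right]
    by_contra hne
    refine hκ (funext fun j => ?_)
    have h1 := left_ne_zero_of_mul hne
    have h2 := right_ne_zero_of_mul hne
    rw [ne_eq, ite_eq_right_iff, not_forall] at h1 h2
    obtain ⟨h1, -⟩ := h1
    obtain ⟨h2, -⟩ := h2
    by_cases hj : (j : L.sites) ∈ S
    · simp only [ν, hj, if_true]
      exact (h1 j (hST j hj)).symm
    · simp only [ν, hj, if_false]
      exact h2 j hj
  · simp
  · intro κ _ hκ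
    rw [transfer_apply_of_subset Finset.subset_union_left,
      transfer_apply_of_subset Finset.subset_union_right]
    by_contra hne
    refine hκ (funext fun j => ?_)
    have h1 := left_ne_zero_of_mul hne
    have h2 := right_ne_zero_of_mul hne
    rw [ne_eq, ite_eq_right_iff, not_forall] at h1 h2
    obtain ⟨h1, -⟩ := h1
    obtain ⟨h2, -⟩ := h2
    by_cases hj : (j : L.sites) ∈ S
    · simp only [μ, hj, if_true]
      exact h2 j (hST j hj)
    · simp only [μ, hj, if_false]
      exact (h1 j hj).symm
  · simp

theorem component_zero {S : Finset L.sites} (Z : Brick n) : component Z (0 : L.Loc S) = 0 := by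
  simp [component]

theorem norm_component_le {S : Finset L.sites} (Z : Brick n) (a : L.Loc S) :
    ‖component Z a‖ ≤ 4 ^ n * ‖a‖ := by
  calc ‖component Z a‖ ≤ ∑ c : Finset (Fin n × Bool), ‖a‖ := by
        refine norm_sum_le_of_le _ fun c _ => ?_
        rw [norm_smul]
        simpa using (norm_transfer_le _).trans (norm_transfer_le a)
    _ = 4 ^ n * ‖a‖ := by
        rw [Finset.sum_const, Finset.card_univ, Fintype.card_finset, nsmul_eq_mul]
        have : (4 : ℝ) = 2 ^ 2 := by norm_num
        simp [this, ← pow_mul, mul_comm]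

theorem component_conjTranspose {S : Finset L.sites} (Z : Brick n) {a : L.Loc S}
    (ha : a.conjTranspose = -a) : (component Z a).conjTranspose = -component Z a := by
  rw [component, Matrix.conjTranspose_sum, ← Finset.sum_neg_distrib]
  refine Finset.sum_congr rfl fun c _ => ?_
  rw [Matrix.conjTranspose_smul, transfer_conjTranspose, transfer_conjTranspose, ha]
  simp

theorem trace_component {S : Finset L.sites} (Z : Brick n) {a : L.Loc S} (ha : a.trace = 0) :
    (component Z a).trace = 0 := by
  rw [component, Matrix.trace_sum]
  refine Finset.sum_eq_zero fun c _ => ?_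
  rw [Matrix.trace_smul, trace_transfer, trace_transfer, ha]
  simp

/-- An alternating sum over the subsets of a finite set vanishes if its terms do not change when a
fixed element `e` is added or removed. -/
theorem sum_neg_one_pow_card_smul_eq_zero {α M : Type*} [Fintype α] [DecidableEq α]
    [AddCommGroup M] [Module ℂ M] (e : α) (g : Finset α → M)
    (hg : ∀ c, e ∉ c → g (insert e c) = g c) :
    ∑ c : Finset α, (-1 : ℂ) ^ c.card • g c = 0 := by
  rw [← Finset.powerset_univ, ← Finset.insert_erase (Finset.mem_univ e),
    Finset.sum_powerset_insert (Finset.notMem_erase _ _), ← Finset.sum_add_distrib]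
  refine Finset.sum_eq_zero fun c hc => ?_
  have he : e ∉ c := fun h => Finset.notMem_erase e _ (Finset.mem_powerset.1 hc h)
  rw [hg c he, Finset.card_insert_of_notMem he, pow_succ]
  simp

theorem mem_brickSites {Y : Brick n} {j : L.sites} :
    j ∈ L.brickSites Y ↔ (j : Fin n → ℝ) ∈ Y.toSet := by
  simp [brickSites]

theorem mem_shrinkSites {Y : Brick n} {c : Finset (Fin n × Bool)} {j : L.sites} :
    j ∈ L.shrinkSites Y c ↔ (j : Fin n → ℝ) ∈ Y.toSet ∧ (j : Fin n → ℝ) ∈ Y.shrink c := by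
  classical
  simp [shrinkSites, mem_brickSites]

/-- A point which stays in the brick after moving in the face `e` is not affected by `e`. -/
theorem mem_shrinkSites_insert {Z : Brick n} {e : Fin n × Bool} {j : L.sites}
    (he : (j : Fin n → ℝ) ∈ Z.shrink {e}) (c : Finset (Fin n × Bool)) :
    j ∈ L.shrinkSites Z (insert e c) ↔ j ∈ L.shrinkSites Z c := by
  rw [mem_shrinkSites, mem_shrinkSites]
  refine and_congr_right fun _ => forall_congr' fun i => ?_
  have h := he i
  obtain ⟨i', b⟩ := e
  by_cases hi : i = i'
  · subst hi
    cases b <;> simp at h ⊢ <;> intros <;> split_ifs <;> constructor <;> intro <;> linarith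
  · simp [hi]

/-- The component at `Z` of an observable supported away from a face of `Z` vanishes. -/
theorem component_eq_zero {S : Finset L.sites} {Z : Brick n} (e : Fin n × Bool)
    (h : ∀ j ∈ S, (j : Fin n → ℝ) ∈ Z.toSet → (j : Fin n → ℝ) ∈ Z.shrink {e}) (a : L.Loc S) :
    component Z a = 0 := by
  classical
  refine sum_neg_one_pow_card_smul_eq_zero e
    (fun c => transfer (L.shrinkSites Z c) (L.brickSites Z) (transfer S (L.shrinkSites Z c) a))
    fun c _ => transfer_transfer_congr a fun j hS hZ => ?_
  exact mem_shrinkSites_insert (h j hS (mem_brickSites.1 hZ)) c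

/-- The partial traces of a component onto smaller bricks vanish. -/
theorem transfer_component {S : Finset L.sites} {Z X : Brick n} (hX : X < Z) (a : L.Loc S) :
    transfer (L.brickSites Z) (L.brickSites X) (component Z a) = 0 := by
  classical
  obtain ⟨e, he⟩ : ∃ e : Fin n × Bool, X.toSet ⊆ Z.shrink {e} := by
    obtain ⟨hle, hnle⟩ := hX
    have h1 : ∀ i, Z.fst i ≤ X.fst i := hle.1
    have h2 : ∀ i, X.snd i ≤ Z.snd i := hle.2
    by_cases h3 : ∀ i, X.fst i ≤ Z.fst i
    · have h4 : ¬ ∀ i, Z.snd i ≤ X.snd i := fun h4 => hnle ⟨h3, h4⟩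
      push Not at h4
      obtain ⟨i, hi⟩ := h4
      refine ⟨(i, true), fun x hx i' => ?_⟩
      have hx' := hx i'
      have h1' : (Z.fst i' : ℝ) ≤ X.fst i' := by exact_mod_cast h1 i'
      have h2' : (X.snd i' : ℝ) ≤ Z.snd i' := by exact_mod_cast h2 i'
      have hi' : (X.snd i : ℝ) + 1 ≤ Z.snd i := by exact_mod_cast hi
      by_cases hii : i' = i
      · subst hii
        simp
        constructor <;> linarith [hx'.1, hx'.2]
      · simp [hii]
        constructor <;> linarith [hx'.1, hx'.2]
    · push Not at h3
      obtain ⟨i, hi⟩ := h3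
      refine ⟨(i, false), fun x hx i' => ?_⟩
      have hx' := hx i'
      have h1' : (Z.fst i' : ℝ) ≤ X.fst i' := by exact_mod_cast h1 i'
      have h2' : (X.snd i' : ℝ) ≤ Z.snd i' := by exact_mod_cast h2 i'
      have hi' : (Z.fst i : ℝ) + 1 ≤ X.fst i := by exact_mod_cast hi
      by_cases hii : i' = i
      · subst hii
        simp
        constructor <;> linarith [hx'.1, hx'.2]
      · simp [hii]
        constructor <;> linarith [hx'.1, hx'.2]
  rw [component, map_sum]
  simp only [map_smul]
  have hsub : ∀ c, transfer (L.brickSites Z) (L.brickSites X) (transfer (L.shrinkSites Z c)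
      (L.brickSites Z) (transfer S (L.shrinkSites Z c) a)) =
      transfer (L.shrinkSites Z c) (L.brickSites X) (transfer S (L.shrinkSites Z c) a) :=
    fun c => transfer_transfer _ fun j hj _ => mem_brickSites.2 (mem_shrinkSites.1 hj).1
  simp only [hsub]
  refine sum_neg_one_pow_card_smul_eq_zero e
    (fun c => transfer (L.shrinkSites Z c) (L.brickSites X) (transfer S (L.shrinkSites Z c) a))
    fun c _ => transfer_transfer_congr a fun j _ hj => ?_
  exact mem_shrinkSites_insert (he (mem_brickSites.1 hj)) c

theorem component_mem_brickPart {S : Finset L.sites} (Z : Brick n) {a : L.Loc S}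
    (ha : a.conjTranspose = -a) (ha' : a.trace = 0) : component Z a ∈ L.brickPart Z :=
  ⟨component_conjTranspose Z ha, trace_component Z ha', fun _ hX => transfer_component hX a⟩

/-- The real subspace `𝔡_l^Y`. -/
def brickSubmodule (L : LatticeSystem n) (Y : Brick n) : Submodule ℝ (L.Loc (L.brickSites Y)) where
  carrier := L.brickPart Y
  zero_mem' := by simp [brickPart]
  add_mem' := by
    rintro a b ⟨ha, ha', ha''⟩ ⟨hb, hb', hb''⟩
    refine ⟨?_, ?_, fun X hX => ?_⟩
    · rw [Matrix.conjTranspose_add, ha, hb, neg_add]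
    · rw [Matrix.trace_add, ha', hb', add_zero]
    · rw [map_add, ha'' X hX, hb'' X hX, add_zero]
  smul_mem' := by
    rintro c a ⟨ha, ha', ha''⟩
    refine ⟨?_, ?_, fun X hX => ?_⟩
    · rw [Matrix.conjTranspose_smul, ha, smul_neg, star_trivial]
    · rw [Matrix.trace_smul, ha', smul_zero]
    · rw [← Complex.coe_smul, map_smul, ha'' X hX, smul_zero]

theorem isClosed_brickSubmodule (Y : Brick n) :
    IsClosed (L.brickSubmodule Y : Set (L.Loc (L.brickSites Y))) :=
  (L.brickSubmodule Y).closed_of_finiteDimensional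

/-! ### Local observables as operators, and averages -/

theorem resConf_updConf {S : Finset L.sites} (β : L.Conf S) (σ : L.GlobalConf) :
    resConf S (updConf β σ) = β := by
  funext j
  simp [resConf, updConf]

theorem updConf_updConf {S : Finset L.sites} (γ β : L.Conf S) (σ : L.GlobalConf) :
    updConf γ (updConf β σ) = updConf γ σ := by
  funext j
  by_cases hj : j ∈ S <;> simp [updConf, hj]

theorem updConf_resConf {S : Finset L.sites} (σ : L.GlobalConf) :
    updConf (resConf S σ) σ = σ := by
  funext j
  by_cases hj : j ∈ S <;> simp [updConf, resConf, hj]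

open scoped Classical in
theorem unitOp_apply {S : Finset L.sites} (α β : L.Conf S) (φ : L.Hilb) (σ : L.GlobalConf) :
    unitOp α β φ σ = if resConf S σ = α then φ (updConf β σ) else 0 := rfl

theorem rep_apply {S : Finset L.sites} (a : L.Loc S) (φ : L.Hilb) (σ : L.GlobalConf) :
    rep S a φ σ = ∑ β, a (resConf S σ) β * φ (updConf β σ) := by
  classical
  have h : rep S a φ = ∑ α, ∑ β, a α β • unitOp α β φ := by
    simp [rep]
  rw [h, lp.coeFn_sum, Finset.sum_apply]
  simp only [lp.coeFn_sum, Finset.sum_apply, lp.coeFn_smul, Pi.smul_apply, smul_eq_mul,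
    unitOp_apply]
  rw [Finset.sum_eq_single (resConf S σ)]
  · simp
  · intro α _ hα
    simp [hα.symm]
  · simp

theorem rep_mul {S : Finset L.sites} (a b : L.Loc S) : rep S (a * b) = rep S a * rep S b := by
  ext φ σ
  rw [mul_apply_eq_comp, rep_apply, rep_apply]
  simp only [rep_apply, Matrix.mul_apply, resConf_updConf, updConf_updConf, Finset.sum_mul,
    Finset.mul_sum, mul_assoc]
  rw [Finset.sum_comm]

theorem inner_unitOp {S : Finset L.sites} (α β : L.Conf S) (φ χ : L.Hilb) :
    inner ℂ (unitOp α β φ) χ = inner ℂ φ (unitOp β α χ) := by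
  classical
  -- exchange `α` and `β` on `S`
  let e : L.GlobalConf → L.GlobalConf := fun σ =>
    if resConf S σ = α then updConf β σ else if resConf S σ = β then updConf α σ else σ
  have he : Function.Involutive e := by
    intro σ
    by_cases h1 : resConf S σ = α
    · have h2 : e σ = updConf β σ := if_pos h1
      by_cases h3 : β = α
      · rw [h2, h3, ← h1, updConf_resConf, h2, h3, ← h1, updConf_resConf]
      · have h5 : e (updConf β σ) = updConf α (updConf β σ) := by
          simp only [e, resConf_updConf, h3, if_false, if_true]
        rw [h2, h5, updConf_updConf, ← h1, updConf_resConf]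
    · by_cases h4 : resConf S σ = β
      · have h2 : e σ = updConf α σ := (if_neg h1).trans (if_pos h4)
        rw [h2]
        simp [e, resConf_updConf, updConf_updConf, ← h4, updConf_resConf]
      · simp [e, h1, h4]
  rw [lp.inner_eq_tsum, lp.inner_eq_tsum, ← he.toPerm.tsum_eq]
  refine tsum_congr fun σ => ?_
  rw [Function.Involutive.coe_toPerm, unitOp_apply, unitOp_apply]
  by_cases h1 : resConf S σ = α
  · have h2 : e σ = updConf β σ := if_pos h1
    rw [h2, resConf_updConf, updConf_updConf]
    by_cases h3 : β = α
    · rw [if_pos h3, if_pos (h1.trans h3.symm), h3, ← h1, updConf_resConf]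
    · rw [if_neg h3, if_neg fun h => h3 (h.symm.trans h1)]
      simp
  · by_cases h4 : resConf S σ = β
    · have h2 : e σ = updConf α σ := (if_neg h1).trans (if_pos h4)
      rw [h2, resConf_updConf, updConf_updConf, if_pos rfl, if_pos h4, ← h4, updConf_resConf]
    · have h2 : e σ = σ := by simp [e, h1, h4]
      rw [h2, if_neg h1, if_neg h4]
      simp

theorem star_unitOp {S : Finset L.sites} (α β : L.Conf S) :
    star (unitOp α β) = unitOp β α := by
  rw [ContinuousLinearMap.star_eq_adjoint]
  exact ((ContinuousLinearMap.eq_adjoint_iff _ _).2 fun φ χ => inner_unitOp β α φ χ).symm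

theorem rep_star {S : Finset L.sites} (a : L.Loc S) : rep S (star a) = star (rep S a) := by
  have h : ∀ b : L.Loc S, rep S b = ∑ α, ∑ β, b α β • unitOp α β := fun _ => rfl
  rw [h, h, star_sum, Finset.sum_comm]
  refine Finset.sum_congr rfl fun α _ => ?_
  rw [star_sum]
  refine Finset.sum_congr rfl fun β _ => ?_
  rw [star_smul, star_unitOp]
  rfl

/-- A homomorphism of `C*`-algebras is contractive. -/
theorem norm_rep_le {S : Finset L.sites} (a : L.Loc S) : ‖rep S a‖ ≤ ‖a‖ := by
  let D : L.Loc S →⋆ₙₐ[ℂ] (L.Hilb →L[ℂ] L.Hilb) :=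
    { toFun := rep S
      map_smul' := fun c M => map_smul (rep S) c M
      map_zero' := map_zero (rep S)
      map_add' := map_add (rep S)
      map_mul' := rep_mul
      map_star' := rep_star }
  exact NonUnitalStarAlgHom.norm_apply_le D a

instance : CompleteSpace L.quasiLocal :=
  (StarSubalgebra.isClosed_topologicalClosure _).completeSpace_coe

/-- The inclusion of the observables on `S` into the quasi-local algebra. -/
def inclCLM (S : Finset L.sites) : L.Loc S →L[ℂ] L.quasiLocal :=
  LinearMap.mkContinuous
    { toFun := incl S
      map_add' := fun a b => Subtype.ext (map_add (rep S) a b)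
      map_smul' := fun c a => Subtype.ext (map_smul (rep S) c a) } 1
    fun a => (norm_rep_le a).trans_eq (one_mul _).symm

theorem inclCLM_apply {S : Finset L.sites} (a : L.Loc S) : inclCLM S a = incl S a := rfl

theorem norm_incl_le {S : Finset L.sites} (a : L.Loc S) : ‖incl S a‖ ≤ ‖a‖ := norm_rep_le a

theorem summable_incl {F : L.Family} (hF : Summable fun Y => ‖F Y‖) :
    Summable fun Y => incl (L.brickSites Y) (F Y) :=
  Summable.of_norm_bounded hF fun _ => norm_incl_le _

theorem average_add (ψ : L.State) {F G : L.Family} (hF : Summable fun Y => ‖F Y‖)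
    (hG : Summable fun Y => ‖G Y‖) : average ψ (F + G) = average ψ F + average ψ G := by
  rw [average, average, average, ← map_add, ← (summable_incl hF).tsum_add (summable_incl hG)]
  simp only [Pi.add_apply, ← inclCLM_apply, map_add]

theorem average_smul (ψ : L.State) (r : ℝ) {F : L.Family} (hF : Summable fun Y => ‖F Y‖) :
    average ψ (r • F) = r • average ψ F := by
  have h : ∀ Y, incl (L.brickSites Y) ((r • F) Y) = (r : ℂ) • incl (L.brickSites Y) (F Y) := by
    intro Y
    rw [← inclCLM_apply, ← inclCLM_apply, ← map_smul, Complex.coe_smul]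
    rfl
  rw [average, average, tsum_congr h, (summable_incl hF).tsum_const_smul, map_smul,
    Complex.coe_smul]

end LatticeSystem

/-! ### Distances and summation over bricks -/

theorem setDist_nonneg {n : ℕ} (U V : Set (Fin n → ℝ)) : 0 ≤ setDist U V :=
  Real.iInf_nonneg fun _ => dist_nonneg

theorem setDist_le_dist {n : ℕ} {U V : Set (Fin n → ℝ)} {x y : Fin n → ℝ} (hx : x ∈ U)
    (hy : y ∈ V) : setDist U V ≤ dist x y :=
  ciInf_le (f := fun p : U × V => dist (p.1 : Fin n → ℝ) (p.2 : Fin n → ℝ))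
    ⟨0, by rintro _ ⟨p, rfl⟩; exact dist_nonneg⟩ (⟨x, hx⟩, ⟨y, hy⟩)

theorem exists_dist_lt_setDist_add {n : ℕ} {U V : Set (Fin n → ℝ)} (hU : U.Nonempty)
    (hV : V.Nonempty) {ε : ℝ} (hε : 0 < ε) : ∃ x ∈ U, ∃ y ∈ V, dist x y < setDist U V + ε := by
  have : Nonempty (U × V) := ⟨⟨⟨_, hU.some_mem⟩, ⟨_, hV.some_mem⟩⟩⟩
  obtain ⟨⟨x, y⟩, h⟩ := exists_lt_of_ciInf_lt (lt_add_of_pos_right (setDist U V) hε)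
  exact ⟨x, x.2, y, y.2, h⟩

namespace Brick

variable {n : ℕ}

theorem fst_mem (Y : Brick n) : (fun i => (Y.fst i : ℝ)) ∈ Y.toSet := fun i =>
  ⟨le_rfl, Int.cast_le.2 (Y.fst_le_snd i)⟩

theorem snd_mem (Y : Brick n) : (fun i => (Y.snd i : ℝ)) ∈ Y.toSet := fun i =>
  ⟨Int.cast_le.2 (Y.fst_le_snd i), le_rfl⟩

theorem nonempty (Y : Brick n) : Y.toSet.Nonempty := ⟨_, Y.fst_mem⟩

theorem isBounded (Y : Brick n) : Bornology.IsBounded Y.toSet := by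
  refine (Metric.isBounded_Icc (fun i => (Y.fst i : ℝ)) (fun i => (Y.snd i : ℝ))).subset ?_
  exact fun x hx => ⟨fun i => (hx i).1, fun i => (hx i).2⟩

/-- The diameter of a brick. -/
def diam (Y : Brick n) : ℝ := Metric.diam Y.toSet

theorem diam_nonneg (Y : Brick n) : 0 ≤ Y.diam := Metric.diam_nonneg

theorem dist_le_diam {Y : Brick n} {x y : Fin n → ℝ} (hx : x ∈ Y.toSet) (hy : y ∈ Y.toSet) :
    dist x y ≤ Y.diam := Metric.dist_le_diam_of_mem Y.isBounded hx hy

theorem abs_sub_le_diam {Y : Brick n} {x y : Fin n → ℝ} (hx : x ∈ Y.toSet) (hy : y ∈ Y.toSet)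
    (i : Fin n) : |x i - y i| ≤ Y.diam :=
  (dist_le_pi_dist x y i).trans (dist_le_diam hx hy)

/-- The quantity `1 + diam Y + d(U, Y)` which controls the decay of a family localized on `U`. -/
def weight (U : Set (Fin n → ℝ)) (Y : Brick n) : ℝ := 1 + Y.diam + setDist U Y.toSet

theorem one_le_weight (U : Set (Fin n → ℝ)) (Y : Brick n) : 1 ≤ Y.weight U := by
  have := Y.diam_nonneg
  have := setDist_nonneg U Y.toSet
  unfold weight
  linarith

theorem one_add_diam_le_weight (U : Set (Fin n → ℝ)) (Y : Brick n) : 1 + Y.diam ≤ Y.weight U := by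
  have := setDist_nonneg U Y.toSet
  unfold weight
  linarith

theorem exists_dist_lt_setDist {U : Set (Fin n → ℝ)} (hU : U.Nonempty) {Y : Brick n}
    {x : Fin n → ℝ} (hx : x ∈ Y.toSet) {ε : ℝ} (hε : 0 < ε) :
    ∃ u ∈ U, dist u x < setDist U Y.toSet + Y.diam + ε := by
  obtain ⟨u, hu, y, hy, h⟩ := exists_dist_lt_setDist_add hU Y.nonempty hε
  refine ⟨u, hu, ?_⟩
  linarith [dist_triangle u y x, dist_le_diam hy hx]

/-- The geometric consequences of `[F^X, G^Y]^Z ≠ 0`: the bricks `X` and `Y` meet, and `Z` lies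
within distance `diam X + diam Y` of a common point. -/
def Linked (X Y Z : Brick n) (x : Fin n → ℝ) : Prop :=
  x ∈ X.toSet ∧ x ∈ Y.toSet ∧ ∀ z ∈ Z.toSet, dist z x ≤ X.diam + Y.diam

theorem Linked.symm {X Y Z : Brick n} {x : Fin n → ℝ} (h : Linked X Y Z x) : Linked Y X Z x :=
  ⟨h.2.1, h.1, fun z hz => (h.2.2 z hz).trans_eq (add_comm _ _)⟩

theorem Linked.weight_le {X Y Z : Brick n} {x : Fin n → ℝ} (h : Linked X Y Z x)
    {U : Set (Fin n → ℝ)} (hU : U.Nonempty) : Z.weight U ≤ 4 * (X.weight U * (1 + Y.diam)) := by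
  have hX := X.diam_nonneg
  have hY := Y.diam_nonneg
  have hZ : Z.diam ≤ 2 * (X.diam + Y.diam) := by
    refine Metric.diam_le_of_forall_dist_le (by positivity) fun z hz z' hz' => ?_
    have h1 := dist_triangle_right z z' x
    linarith [h.2.2 z hz, h.2.2 z' hz']
  have hd : setDist U Z.toSet ≤ setDist U X.toSet + 2 * X.diam + Y.diam := by
    refine le_of_forall_pos_le_add fun ε hε => ?_
    obtain ⟨u, hu, hux⟩ := exists_dist_lt_setDist hU h.1 hε
    have h1 := setDist_le_dist hu Z.fst_mem
    have h2 := dist_triangle_right u (fun i => (Z.fst i : ℝ)) x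
    linarith [h.2.2 _ Z.fst_mem]
  have hs := setDist_nonneg U X.toSet
  have : 0 ≤ X.diam * Y.diam := by positivity
  have : 0 ≤ setDist U X.toSet * Y.diam := by positivity
  unfold weight
  nlinarith

end Brick

/-- A summable function on `ℤⁿ` of polynomial decay. -/
def latticeWeight {n : ℕ} (v : Fin n → ℤ) : ℝ := ∏ i, ((1 + |(v i : ℝ)|) ^ 2)⁻¹

theorem latticeWeight_nonneg {n : ℕ} (v : Fin n → ℤ) : 0 ≤ latticeWeight v :=
  Finset.prod_nonneg fun _ _ => by positivity

theorem summable_one_add_abs_sq_inv : Summable fun k : ℤ => ((1 + |(k : ℝ)|) ^ 2)⁻¹ := by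
  have h : Summable fun k : ℕ => ((1 + |(k : ℝ)|) ^ 2)⁻¹ := by
    have h1 := (summable_nat_add_iff 1).2 (Real.summable_nat_pow_inv.2 one_lt_two)
    refine h1.congr fun k => ?_
    rw [abs_of_nonneg (Nat.cast_nonneg k)]
    push_cast
    ring
  exact Summable.of_nat_of_neg (by simpa using h) (by simpa using h)

theorem summable_latticeWeight (n : ℕ) : Summable (latticeWeight (n := n)) := by
  classical
  refine summable_of_sum_le (c := (∑' k : ℤ, ((1 + |(k : ℝ)|) ^ 2)⁻¹) ^ n) latticeWeight_nonneg
    fun u => ?_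
  calc ∑ v ∈ u, latticeWeight v
      ≤ ∑ v ∈ Fintype.piFinset fun i => u.image fun v => v i, latticeWeight v := by
        refine Finset.sum_le_sum_of_subset_of_nonneg (fun v hv => ?_)
          fun v _ _ => latticeWeight_nonneg v
        exact Fintype.mem_piFinset.2 fun i => Finset.mem_image_of_mem _ hv
    _ = ∏ i, ∑ k ∈ u.image (fun v : Fin n → ℤ => v i), ((1 + |((k : ℤ) : ℝ)|) ^ 2)⁻¹ := by
        rw [Finset.prod_univ_sum]
        rfl
    _ ≤ ∏ _i : Fin n, ∑' k : ℤ, ((1 + |(k : ℝ)|) ^ 2)⁻¹ := by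
        refine Finset.prod_le_prod (fun i _ => Finset.sum_nonneg fun _ _ => by positivity)
          fun i _ => ?_
        exact summable_one_add_abs_sq_inv.sum_le_tsum _ fun _ _ => by positivity
    _ = _ := by simp

theorem inv_pow_le_latticeWeight {n : ℕ} {v : Fin n → ℤ} {q : ℝ}
    (h : ∀ i, 1 + |(v i : ℝ)| ≤ q) : (q ^ (2 * n))⁻¹ ≤ latticeWeight v := by
  calc (q ^ (2 * n))⁻¹ = ∏ _i : Fin n, (q ^ 2)⁻¹ := by simp [pow_mul]
    _ ≤ latticeWeight v := Finset.prod_le_prod (fun i _ => by positivity) fun i _ => by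
        have := h i
        gcongr

/-- A summable function on bricks, of polynomial decay in the distances of the two extremal corners
from `z`. -/
def brickWeight {n : ℕ} (z : Fin n → ℤ) (Y : Brick n) : ℝ :=
  latticeWeight (Y.fst - z) * latticeWeight (Y.snd - z)

theorem brickWeight_nonneg {n : ℕ} (z : Fin n → ℤ) (Y : Brick n) : 0 ≤ brickWeight z Y :=
  mul_nonneg (latticeWeight_nonneg _) (latticeWeight_nonneg _)

theorem summable_brickWeight_and_tsum_le (n : ℕ) :
    ∃ T : ℝ, ∀ z : Fin n → ℤ, Summable (brickWeight z) ∧ ∑' Y, brickWeight z Y ≤ T := by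
  have hs := summable_latticeWeight n
  obtain ⟨g, hg⟩ : ∃ g : (Fin n → ℤ) × (Fin n → ℤ) → ℝ,
    g = fun p => latticeWeight p.1 * latticeWeight p.2 := ⟨_, rfl⟩
  have h2 : Summable g := by
    rw [hg]
    exact hs.mul_of_nonneg hs latticeWeight_nonneg latticeWeight_nonneg
  have hg0 : ∀ p, 0 ≤ g p := fun p => by
    rw [hg]
    exact mul_nonneg (latticeWeight_nonneg _) (latticeWeight_nonneg _)
  refine ⟨∑' p, g p, fun z => ?_⟩
  have hinj : Function.Injective fun Y : Brick n => (Y.fst - z, Y.snd - z) := by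
    intro X Y h
    have h1 := congrArg Prod.fst h
    have h2 := congrArg Prod.snd h
    simp only [sub_left_inj] at h1 h2
    exact NonemptyInterval.ext (Prod.ext h1 h2)
  have he : brickWeight z = g ∘ fun Y : Brick n => (Y.fst - z, Y.snd - z) := by
    rw [hg]
    rfl
  have hsum : Summable (g ∘ fun Y : Brick n => (Y.fst - z, Y.snd - z)) := h2.comp_injective hinj
  rw [he]
  exact ⟨hsum, hsum.tsum_le_tsum_of_inj _ hinj (fun p _ => hg0 p) (fun _ => le_rfl) h2⟩

theorem inv_pow_le_brickWeight {n : ℕ} {z : Fin n → ℤ} {Y : Brick n} {q : ℝ}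
    (hq : 0 ≤ q) (h1 : ∀ i, 1 + |(Y.fst i : ℝ) - z i| ≤ q)
    (h2 : ∀ i, 1 + |(Y.snd i : ℝ) - z i| ≤ q) :
    (q ^ (4 * n))⁻¹ ≤ brickWeight z Y := by
  have e : (q ^ (4 * n))⁻¹ = (q ^ (2 * n))⁻¹ * (q ^ (2 * n))⁻¹ := by
    rw [← mul_inv, ← pow_add]
    congr 2
    ring
  rw [e]
  exact mul_le_mul (inv_pow_le_latticeWeight (by simpa using h1))
    (inv_pow_le_latticeWeight (by simpa using h2)) (by positivity) (latticeWeight_nonneg _)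

namespace LatticeSystem

variable {n : ℕ} {L : LatticeSystem n}

/-- A nonzero component `[a, b]^Z` links the bricks. -/
theorem exists_linked {X Y Z : Brick n} {a : L.Loc (L.brickSites X)} {b : L.Loc (L.brickSites Y)}
    (h : component Z (comm a b) ≠ 0) : ∃ x, Brick.Linked X Y Z x := by
  classical
  have hXY : ¬ Disjoint (L.brickSites X) (L.brickSites Y) := fun hd =>
    h (by rw [comm_eq_zero hd, component_zero])
  obtain ⟨j, hjX, hjY⟩ := Finset.not_disjoint_iff.1 hXY
  rw [mem_brickSites] at hjX hjY
  refine ⟨j, hjX, hjY, fun z hz => ?_⟩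
  have hlo : ∀ i, min (X.fst i) (Y.fst i) ≤ Z.fst i := by
    intro i
    by_contra hi
    push Not at hi
    have h1 : (Z.fst i : ℝ) + 1 ≤ X.fst i := by exact_mod_cast (lt_min_iff.1 hi).1
    have h2 : (Z.fst i : ℝ) + 1 ≤ Y.fst i := by exact_mod_cast (lt_min_iff.1 hi).2
    refine h (component_eq_zero (i, false) (fun j hj hjZ i' => ?_) _)
    by_cases hi' : i' = i
    · subst hi'
      rcases Finset.mem_union.1 hj with hj | hj
      · have := mem_brickSites.1 hj i'
        have := hjZ i'
        simp
        constructor <;> linarith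
      · have := mem_brickSites.1 hj i'
        have := hjZ i'
        simp
        constructor <;> linarith
    · simpa [hi'] using hjZ i'
  have hhi : ∀ i, Z.snd i ≤ max (X.snd i) (Y.snd i) := by
    intro i
    by_contra hi
    push Not at hi
    have h1 : (X.snd i : ℝ) + 1 ≤ Z.snd i := by exact_mod_cast (max_lt_iff.1 hi).1
    have h2 : (Y.snd i : ℝ) + 1 ≤ Z.snd i := by exact_mod_cast (max_lt_iff.1 hi).2
    refine h (component_eq_zero (i, true) (fun j hj hjZ i' => ?_) _)
    by_cases hi' : i' = i
    · subst hi'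
      rcases Finset.mem_union.1 hj with hj | hj
      · have := mem_brickSites.1 hj i'
        have := hjZ i'
        simp
        constructor <;> linarith
      · have := mem_brickSites.1 hj i'
        have := hjZ i'
        simp
        constructor <;> linarith
    · simpa [hi'] using hjZ i'
  have hdX := X.diam_nonneg
  have hdY := Y.diam_nonneg
  refine (dist_pi_le_iff (by positivity)).2 fun i => ?_
  rw [Real.dist_eq, abs_le]
  have hX1 := abs_le.1 (Brick.abs_sub_le_diam hjX X.fst_mem i)
  have hX2 := abs_le.1 (Brick.abs_sub_le_diam hjX X.snd_mem i)
  have hY1 := abs_le.1 (Brick.abs_sub_le_diam hjY Y.fst_mem i)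
  have hY2 := abs_le.1 (Brick.abs_sub_le_diam hjY Y.snd_mem i)
  have hzi := hz i
  constructor
  · rcases min_le_iff.1 (hlo i) with h1 | h1
    · have h1' : (X.fst i : ℝ) ≤ Z.fst i := by exact_mod_cast h1
      linarith
    · have h1' : (Y.fst i : ℝ) ≤ Z.fst i := by exact_mod_cast h1
      linarith
  · rcases le_max_iff.1 (hhi i) with h1 | h1
    · have h1' : (Z.snd i : ℝ) ≤ X.snd i := by exact_mod_cast h1
      linarith
    · have h1' : (Z.snd i : ℝ) ≤ Y.snd i := by exact_mod_cast h1
      linarith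

/-! ### The bracket of almost local derivations -/

theorem Dal.exists_bound {U : Set (Fin n → ℝ)} {F : L.Family} (hF : F ∈ L.Dal U) (k : ℕ) :
    ∃ C : ℝ, 0 ≤ C ∧ ∀ Y, ‖F Y‖ * Y.weight U ^ k ≤ C := by
  obtain ⟨C, hC⟩ := hF.2 k
  exact ⟨max C 0, le_max_right _ _, fun Y => (hC Y).trans (le_max_left _ _)⟩

/-- The real vector space `𝔇_al(U)`. -/
def dalSubmodule (L : LatticeSystem n) (U : Set (Fin n → ℝ)) : Submodule ℝ L.Family where
  carrier := L.Dal U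
  zero_mem' := ⟨fun Y => (L.brickSubmodule Y).zero_mem, fun _ => ⟨0, fun _ => by simp⟩⟩
  add_mem' := by
    intro F G hF hG
    refine ⟨fun Y => (L.brickSubmodule Y).add_mem (hF.1 Y) (hG.1 Y), fun k => ?_⟩
    obtain ⟨C, hC⟩ := hF.2 k
    obtain ⟨D, hD⟩ := hG.2 k
    refine ⟨C + D, fun Y => (mul_le_mul_of_nonneg_right (norm_add_le _ _)
      (pow_nonneg (zero_le_one.trans (Y.one_le_weight U)) k)).trans ?_⟩
    rw [add_mul]
    exact add_le_add (hC Y) (hD Y)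
  smul_mem' := by
    intro r F hF
    refine ⟨fun Y => (L.brickSubmodule Y).smul_mem r (hF.1 Y), fun k => ?_⟩
    obtain ⟨C, hC⟩ := hF.2 k
    refine ⟨|r| * C, fun Y => ?_⟩
    rw [Pi.smul_apply, norm_smul, mul_assoc, Real.norm_eq_abs]
    exact mul_le_mul_of_nonneg_left (hC Y) (abs_nonneg r)

theorem single_mem_dal (U : Set (Fin n → ℝ)) {Y : Brick n} {a : L.Loc (L.brickSites Y)}
    (ha : a ∈ L.brickPart Y) : (Pi.single Y a : L.Family) ∈ L.Dal U := by
  classical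
  refine ⟨fun X => ?_, fun k => ⟨‖a‖ * Y.weight U ^ k, fun X => ?_⟩⟩
  · by_cases h : X = Y
    · subst h
      simpa using ha
    · rw [Pi.single_eq_of_ne h]
      exact (L.brickSubmodule X).zero_mem
  · by_cases h : X = Y
    · subst h
      rw [Pi.single_eq_same]
      exact le_rfl
    · rw [Pi.single_eq_of_ne h, norm_zero, zero_mul]
      exact mul_nonneg (norm_nonneg _) (pow_nonneg (zero_le_one.trans (Y.one_le_weight U)) k)

theorem summable_norm_of_mem_dal {F : L.Family} (hF : F ∈ L.Dal {0}) :
    Summable fun Y => ‖F Y‖ := by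
  obtain ⟨C, hC0, hC⟩ := Dal.exists_bound hF (4 * n)
  obtain ⟨T, hT⟩ := summable_brickWeight_and_tsum_le n
  refine Summable.of_nonneg_of_le (fun _ => norm_nonneg _) (fun Y => ?_) ((hT 0).1.mul_left C)
  have hw := zero_lt_one.trans_le (Y.one_le_weight {0})
  have hcorner : ∀ y ∈ Y.toSet, ∀ i, 1 + |y i - ((0 : Fin n → ℤ) i : ℝ)| ≤ Y.weight {0} := by
    intro y hy i
    refine le_of_forall_pos_le_add fun ε hε => ?_
    obtain ⟨u, hu, h⟩ := Brick.exists_dist_lt_setDist (Set.singleton_nonempty 0) hy hε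
    rw [Set.mem_singleton_iff] at hu
    subst hu
    have h1 := dist_le_pi_dist y 0 i
    rw [Real.dist_eq, dist_comm] at h1
    unfold Brick.weight
    simp only [Pi.zero_apply, Int.cast_zero] at h1 ⊢
    linarith
  calc ‖F Y‖ ≤ C * (Y.weight {0} ^ (4 * n))⁻¹ := by
        rw [← div_eq_mul_inv, le_div_iff₀ (pow_pos hw _)]
        exact hC Y
    _ ≤ C * brickWeight 0 Y := mul_le_mul_of_nonneg_left
        (inv_pow_le_brickWeight hw.le (hcorner _ Y.fst_mem) (hcorner _ Y.snd_mem)) hC0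

theorem norm_component_comm_le (F G : L.Family) (X Y Z : Brick n) :
    ‖component Z (comm (F X) (G Y))‖ ≤ 2 * 4 ^ n * (‖F X‖ * ‖G Y‖) := by
  refine (norm_component_le Z _).trans ?_
  have := norm_comm_le (F X) (G Y)
  have h4 : (0 : ℝ) < 4 ^ n := by positivity
  nlinarith

/-- A uniform bound by `brickWeight`s for the terms of the bracket. -/
theorem exists_norm_component_comm_le {F G : L.Family} {U : Set (Fin n → ℝ)} (k : ℕ)
    (hbd : ∀ m : ℕ, ∃ C : ℝ, ∀ X Y Z x, Brick.Linked X Y Z x →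
      ‖F X‖ * ‖G Y‖ * (Z.weight U ^ k * ((1 + X.diam) * (1 + Y.diam)) ^ m) ≤ C) :
    ∃ C : ℝ, 0 ≤ C ∧ ∀ X Y Z : Brick n, ‖component Z (comm (F X) (G Y))‖ ≤
      C * (Z.weight U ^ k)⁻¹ * (brickWeight Z.fst X * brickWeight Z.fst Y) := by
  -- a factor `q⁻⁴ⁿ` for each of `X` and `Y`, where `q` bounds the distances of their corners from
  -- a corner of `Z`
  obtain ⟨C, hC⟩ := hbd (4 * n + 4 * n)
  refine ⟨2 * 4 ^ n * max C 0 * 2 ^ (4 * n + 4 * n), by positivity, fun X Y Z => ?_⟩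
  have hw := zero_lt_one.trans_le (Z.one_le_weight U)
  have hbX := brickWeight_nonneg Z.fst X
  have hbY := brickWeight_nonneg Z.fst Y
  by_cases h0 : component Z (comm (F X) (G Y)) = 0
  · rw [h0, norm_zero]
    positivity
  obtain ⟨x, hx⟩ := exists_linked h0
  have hX := X.diam_nonneg
  have hY := Y.diam_nonneg
  have hXY : 0 ≤ X.diam * Y.diam := by positivity
  have hq : 0 < 2 * ((1 + X.diam) * (1 + Y.diam)) := by positivity
  have hz : ∀ i, |(Z.fst i : ℝ) - x i| ≤ X.diam + Y.diam := fun i =>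
    (dist_le_pi_dist _ x i).trans (hx.2.2 _ Z.fst_mem)
  have hcX : ∀ y ∈ X.toSet, ∀ i, 1 + |y i - (Z.fst i : ℝ)| ≤ 2 * ((1 + X.diam) * (1 + Y.diam)) := by
    intro y hy i
    have h1 := Brick.abs_sub_le_diam hy hx.1 i
    have h2 := abs_sub_le (y i) (x i) (Z.fst i)
    rw [abs_sub_comm (x i)] at h2
    linarith [hz i]
  have hcY : ∀ y ∈ Y.toSet, ∀ i, 1 + |y i - (Z.fst i : ℝ)| ≤ 2 * ((1 + X.diam) * (1 + Y.diam)) := by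
    intro y hy i
    have h1 := Brick.abs_sub_le_diam hy hx.2.1 i
    have h2 := abs_sub_le (y i) (x i) (Z.fst i)
    rw [abs_sub_comm (x i)] at h2
    linarith [hz i]
  have hbb : ((2 * ((1 + X.diam) * (1 + Y.diam))) ^ (4 * n + 4 * n))⁻¹ ≤
      brickWeight Z.fst X * brickWeight Z.fst Y := by
    rw [pow_add, mul_inv]
    exact mul_le_mul
      (inv_pow_le_brickWeight hq.le (hcX _ X.fst_mem) (hcX _ X.snd_mem))
      (inv_pow_le_brickWeight hq.le (hcY _ Y.fst_mem) (hcY _ Y.snd_mem)) (by positivity) hbX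
  have hFG : ‖F X‖ * ‖G Y‖ ≤ max C 0 * (Z.weight U ^ k)⁻¹ *
      (((1 + X.diam) * (1 + Y.diam)) ^ (4 * n + 4 * n))⁻¹ := by
    rw [mul_assoc, ← mul_inv, ← div_eq_mul_inv, le_div_iff₀ (by positivity)]
    exact (hC X Y Z x hx).trans (le_max_left _ _)
  calc ‖component Z (comm (F X) (G Y))‖ ≤ 2 * 4 ^ n * (‖F X‖ * ‖G Y‖) :=
        norm_component_comm_le F G X Y Z
    _ ≤ 2 * 4 ^ n * (max C 0 * (Z.weight U ^ k)⁻¹ *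
          (((1 + X.diam) * (1 + Y.diam)) ^ (4 * n + 4 * n))⁻¹) := by gcongr
    _ = 2 * 4 ^ n * max C 0 * 2 ^ (4 * n + 4 * n) * (Z.weight U ^ k)⁻¹ *
          ((2 * ((1 + X.diam) * (1 + Y.diam))) ^ (4 * n + 4 * n))⁻¹ := by
        rw [mul_pow (2 : ℝ), mul_inv]
        have : (2 : ℝ) ^ (4 * n + 4 * n) ≠ 0 := by positivity
        field_simp
    _ ≤ _ := by gcongr

theorem bracket_mem_dal_of_bound {F G : L.Family} {U : Set (Fin n → ℝ)}
    (hF : ∀ Y, F Y ∈ L.brickPart Y) (hG : ∀ Y, G Y ∈ L.brickPart Y)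
    (hbd : ∀ k m : ℕ, ∃ C : ℝ, ∀ X Y Z x, Brick.Linked X Y Z x →
      ‖F X‖ * ‖G Y‖ * (Z.weight U ^ k * ((1 + X.diam) * (1 + Y.diam)) ^ m) ≤ C) :
    bracket F G ∈ L.Dal U := by
  obtain ⟨T, hT⟩ := summable_brickWeight_and_tsum_le n
  have hsum : ∀ z : Fin n → ℤ, Summable fun p : Brick n × Brick n =>
      brickWeight z p.1 * brickWeight z p.2 := fun z =>
    (hT z).1.mul_of_nonneg (hT z).1 (brickWeight_nonneg z) (brickWeight_nonneg z)
  have htsum : ∀ z : Fin n → ℤ,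
      ∑' p : Brick n × Brick n, brickWeight z p.1 * brickWeight z p.2 ≤ T * T := fun z => by
    rw [← (hT z).1.tsum_mul_tsum (hT z).1 (hsum z)]
    have h0 : 0 ≤ ∑' Y, brickWeight z Y := tsum_nonneg (brickWeight_nonneg z)
    exact mul_le_mul (hT z).2 (hT z).2 h0 (h0.trans (hT z).2)
  refine ⟨fun Z => ?_, fun k => ?_⟩
  · obtain ⟨C, hC0, hC⟩ := exists_norm_component_comm_le 0 (hbd 0)
    have hs : Summable fun p : Brick n × Brick n => component Z (comm (F p.1) (G p.2)) :=
      Summable.of_norm_bounded ((hsum Z.fst).mul_left _) fun p => hC p.1 p.2 Z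
    refine (isClosed_brickSubmodule Z).mem_of_tendsto hs.hasSum (Filter.Eventually.of_forall
      fun s => (L.brickSubmodule Z).sum_mem fun p _ => ?_)
    exact component_mem_brickPart Z (comm_conjTranspose (hF p.1).1 (hG p.2).1) (trace_comm _ _)
  · obtain ⟨C, hC0, hC⟩ := exists_norm_component_comm_le k (hbd k)
    refine ⟨C * (T * T), fun Z => ?_⟩
    have hw := zero_lt_one.trans_le (Z.one_le_weight U)
    have h1 : ‖bracket F G Z‖ ≤ C * (Z.weight U ^ k)⁻¹ *
        ∑' p : Brick n × Brick n, brickWeight Z.fst p.1 * brickWeight Z.fst p.2 :=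
      tsum_of_norm_bounded ((hsum Z.fst).hasSum.mul_left _) fun p => hC p.1 p.2 Z
    change ‖bracket F G Z‖ * Z.weight U ^ k ≤ _
    rw [← le_div_iff₀ (pow_pos hw k)]
    refine h1.trans ?_
    rw [div_eq_mul_inv, mul_right_comm]
    exact mul_le_mul_of_nonneg_right (mul_le_mul_of_nonneg_left (htsum _) hC0) (by positivity)

theorem bracket_mem_dal_left {F G : L.Family} {U V : Set (Fin n → ℝ)} (hU : U.Nonempty)
    (hF : F ∈ L.Dal U) (hG : G ∈ L.Dal V) : bracket F G ∈ L.Dal U := by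
  refine bracket_mem_dal_of_bound hF.1 hG.1 fun k m => ?_
  obtain ⟨C, hC0, hC⟩ := Dal.exists_bound hF (k + m)
  obtain ⟨D, hD0, hD⟩ := Dal.exists_bound hG (k + m)
  refine ⟨4 ^ k * (C * D), fun X Y Z x h => ?_⟩
  have hX := X.diam_nonneg
  have hY := Y.diam_nonneg
  have hw := zero_lt_one.trans_le (Z.one_le_weight U)
  have hwX := X.one_add_diam_le_weight U
  have hwY := Y.one_add_diam_le_weight V
  have h0 : 0 ≤ X.weight U := by linarith
  have h0' : 0 ≤ Y.weight V := by linarith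
  calc ‖F X‖ * ‖G Y‖ * (Z.weight U ^ k * ((1 + X.diam) * (1 + Y.diam)) ^ m)
      ≤ ‖F X‖ * ‖G Y‖ * ((4 * (X.weight U * Y.weight V)) ^ k * (X.weight U * Y.weight V) ^ m) := by
        gcongr
        exact (h.weight_le hU).trans (by gcongr)
    _ = 4 ^ k * ((‖F X‖ * X.weight U ^ (k + m)) * (‖G Y‖ * Y.weight V ^ (k + m))) := by ring
    _ ≤ 4 ^ k * (C * D) := by
        have h1 := hC X
        have h2 := hD Y
        gcongr

theorem bracket_mem_dal_right {F G : L.Family} {U V : Set (Fin n → ℝ)} (hV : V.Nonempty)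
    (hF : F ∈ L.Dal U) (hG : G ∈ L.Dal V) : bracket F G ∈ L.Dal V := by
  refine bracket_mem_dal_of_bound hF.1 hG.1 fun k m => ?_
  obtain ⟨C, hC0, hC⟩ := Dal.exists_bound hF (k + m)
  obtain ⟨D, hD0, hD⟩ := Dal.exists_bound hG (k + m)
  refine ⟨4 ^ k * (C * D), fun X Y Z x h => ?_⟩
  have hX := X.diam_nonneg
  have hY := Y.diam_nonneg
  have hw := zero_lt_one.trans_le (Z.one_le_weight V)
  have hwX := X.one_add_diam_le_weight U
  have hwY := Y.one_add_diam_le_weight V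
  have h0 : 0 ≤ Y.weight V := by linarith
  have h0' : 0 ≤ X.weight U := by linarith
  calc ‖F X‖ * ‖G Y‖ * (Z.weight V ^ k * ((1 + X.diam) * (1 + Y.diam)) ^ m)
      ≤ ‖F X‖ * ‖G Y‖ * ((4 * (Y.weight V * X.weight U)) ^ k * (X.weight U * Y.weight V) ^ m) := by
        gcongr
        exact (h.symm.weight_le hV).trans (by gcongr)
    _ = 4 ^ k * ((‖F X‖ * X.weight U ^ (k + m)) * (‖G Y‖ * Y.weight V ^ (k + m))) := by ring
    _ ≤ 4 ^ k * (C * D) := by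
        have h1 := hC X
        have h2 := hD Y
        gcongr

/-- If `F^X` and `G^Y` are jointly small for intersecting `X`, `Y` far from the origin, then the
triple series defining `∑_Z [F, G]^Z` converges absolutely. -/
theorem summable_norm_component_comm {F G : L.Family}
    (hbd : ∀ m : ℕ, ∃ C : ℝ, ∀ (X Y : Brick n), ∀ x ∈ X.toSet, x ∈ Y.toSet →
      ‖F X‖ * ‖G Y‖ * ((1 + ‖x‖) * ((1 + X.diam) * (1 + Y.diam))) ^ m ≤ C) :
    Summable fun p : Brick n × (Brick n × Brick n) =>
      ‖component p.1 (comm (F p.2.1) (G p.2.2))‖ := by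
  -- a factor `q⁻⁴ⁿ` for each of `X`, `Y`, `Z`, where `q` bounds the norms of their corners
  obtain ⟨C, hC⟩ := hbd (4 * n + (4 * n + 4 * n))
  obtain ⟨T, hT⟩ := summable_brickWeight_and_tsum_le n
  have hs := (hT 0).1
  have hn := brickWeight_nonneg (0 : Fin n → ℤ)
  have hs3 := hs.mul_of_nonneg (hs.mul_of_nonneg hs hn hn) hn fun p => mul_nonneg (hn p.1) (hn p.2)
  refine Summable.of_nonneg_of_le (fun _ => norm_nonneg _) ?_
    (hs3.mul_left (2 * 4 ^ n * max C 0))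
  rintro ⟨Z, X, Y⟩
  have hX := X.diam_nonneg
  have hY := Y.diam_nonneg
  by_cases h0 : component Z (comm (F X) (G Y)) = 0
  · rw [h0, norm_zero]
    have := hn X
    have := hn Y
    have := hn Z
    positivity
  obtain ⟨x, hx⟩ := exists_linked h0
  set q := (1 + ‖x‖) * ((1 + X.diam) * (1 + Y.diam)) with hq
  have hq0 : 0 < q := by positivity
  have hdist : ∀ y : Fin n → ℝ, dist y x ≤ X.diam + Y.diam →
      ∀ i, 1 + |y i - ((0 : Fin n → ℤ) i : ℝ)| ≤ q := by
    intro y hy i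
    have h1 := norm_le_pi_norm x i
    rw [Real.norm_eq_abs] at h1
    have h2 : |y i - x i| ≤ X.diam + Y.diam := (dist_le_pi_dist y x i).trans hy
    have h3 := abs_add_le (y i - x i) (x i)
    rw [sub_add_cancel] at h3
    have h5 : 0 ≤ X.diam * Y.diam := by positivity
    have h6 : 0 ≤ ‖x‖ * (X.diam + Y.diam + X.diam * Y.diam) := by positivity
    simp only [Pi.zero_apply, Int.cast_zero, sub_zero]
    have h7 : q = 1 + ‖x‖ + X.diam + Y.diam + X.diam * Y.diam +
        ‖x‖ * (X.diam + Y.diam + X.diam * Y.diam) := by rw [hq]; ring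
    linarith
  have hdX : ∀ y ∈ X.toSet, dist y x ≤ X.diam + Y.diam := fun y hy => by
    linarith [Brick.dist_le_diam hy hx.1]
  have hdY : ∀ y ∈ Y.toSet, dist y x ≤ X.diam + Y.diam := fun y hy => by
    linarith [Brick.dist_le_diam hy hx.2.1]
  have hb : (q ^ (4 * n + (4 * n + 4 * n)))⁻¹ ≤
      brickWeight 0 Z * (brickWeight 0 X * brickWeight 0 Y) := by
    rw [pow_add, pow_add, mul_inv, mul_inv]
    refine mul_le_mul ?_ (mul_le_mul ?_ ?_ (by positivity) (hn X)) (by positivity) (hn Z)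
    · exact inv_pow_le_brickWeight hq0.le (hdist _ (hx.2.2 _ Z.fst_mem))
        (hdist _ (hx.2.2 _ Z.snd_mem))
    · exact inv_pow_le_brickWeight hq0.le (hdist _ (hdX _ X.fst_mem)) (hdist _ (hdX _ X.snd_mem))
    · exact inv_pow_le_brickWeight hq0.le (hdist _ (hdY _ Y.fst_mem)) (hdist _ (hdY _ Y.snd_mem))
  calc ‖component Z (comm (F X) (G Y))‖ ≤ 2 * 4 ^ n * (‖F X‖ * ‖G Y‖) :=
        norm_component_comm_le F G X Y Z
    _ ≤ 2 * 4 ^ n * (max C 0 * (q ^ (4 * n + (4 * n + 4 * n)))⁻¹) := by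
        refine mul_le_mul_of_nonneg_left ?_ (by positivity)
        rw [← div_eq_mul_inv, le_div_iff₀ (by positivity)]
        exact (hC X Y x hx.1 hx.2.1).trans (le_max_left _ _)
    _ = 2 * 4 ^ n * max C 0 * (q ^ (4 * n + (4 * n + 4 * n)))⁻¹ := by ring
    _ ≤ _ := by gcongr

theorem bracket_single_apply (F : L.Family) (Y : Brick n) (a : L.Loc (L.brickSites Y))
    (Z : Brick n) :
    bracket F (Pi.single Y a) Z = ∑' X, component Z (comm (F X) a) := by
  classical
  have hinj : Function.Injective fun X : Brick n => (X, Y) := fun X X' h => congrArg Prod.fst h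
  rw [bracket, ← hinj.tsum_eq]
  · simp
  · rintro ⟨X, Y'⟩ h
    by_cases hY : Y' = Y
    · exact ⟨X, by rw [hY]⟩
    · refine absurd ?_ h
      simp only
      rw [Pi.single_eq_of_ne hY, comm_zero_right, component_zero]

/-- `ψ([F, G]) = ∑_Y ψ([F, G^Y])`, so that `ψ([F, G])` vanishes together with the terms of this
series. -/
theorem average_bracket_eq_zero (ψ : L.State) {F G : L.Family}
    (hs : Summable fun p : Brick n × (Brick n × Brick n) =>
      ‖component p.1 (comm (F p.2.1) (G p.2.2))‖)
    (h0 : ∀ Y, average ψ (bracket F (Pi.single Y (G Y))) = 0) :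
    average ψ (bracket F G) = 0 := by
  have hsum : Summable fun p : Brick n × (Brick n × Brick n) =>
      incl (L.brickSites p.1) (component p.1 (comm (F p.2.1) (G p.2.2))) :=
    Summable.of_norm_bounded hs fun _ => norm_incl_le _
  have hZ : ∀ Z, Summable fun p : Brick n × Brick n => component Z (comm (F p.1) (G p.2)) :=
    fun Z => Summable.of_norm (hs.comp_injective (i := fun p : Brick n × Brick n => (Z, p))
      fun p q h => congrArg Prod.snd h)
  have hZY : ∀ Z Y, Summable fun X : Brick n => component Z (comm (F X) (G Y)) :=
    fun Z Y => (hZ Z).comp_injective (i := fun X => (X, Y)) fun p q h => congrArg Prod.fst h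
  let e : Brick n × (Brick n × Brick n) ≃ Brick n × (Brick n × Brick n) :=
    { toFun := fun p => (p.2.1, p.2.2, p.1)
      invFun := fun p => (p.2.2, p.1, p.2.1)
      left_inv := fun _ => rfl
      right_inv := fun _ => rfl }
  have hsum' : Summable fun p : Brick n × (Brick n × Brick n) =>
      incl (L.brickSites p.2.1) (component p.2.1 (comm (F p.2.2) (G p.1))) :=
    e.summable_iff.2 hsum
  have hY : ∀ Y, Summable fun p : Brick n × Brick n =>
      incl (L.brickSites p.1) (component p.1 (comm (F p.2) (G Y))) := fun Y =>
    hsum'.comp_injective (i := fun p : Brick n × Brick n => (Y, p)) fun p q h => congrArg Prod.snd h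
  have h1 : ∑' Z, incl (L.brickSites Z) (bracket F G Z) =
      ∑' Y, ∑' Z, incl (L.brickSites Z) (bracket F (Pi.single Y (G Y)) Z) := by
    calc ∑' Z, incl (L.brickSites Z) (bracket F G Z)
        = ∑' Z, ∑' p : Brick n × Brick n,
            incl (L.brickSites Z) (component Z (comm (F p.1) (G p.2))) :=
          tsum_congr fun Z => (inclCLM (L.brickSites Z)).map_tsum (hZ Z)
      _ = ∑' p : Brick n × (Brick n × Brick n),
            incl (L.brickSites p.1) (component p.1 (comm (F p.2.1) (G p.2.2))) :=
          hsum.tsum_prod.symm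
      _ = ∑' p : Brick n × (Brick n × Brick n),
            incl (L.brickSites p.2.1) (component p.2.1 (comm (F p.2.2) (G p.1))) :=
          (e.tsum_eq _).symm
      _ = ∑' Y, ∑' p : Brick n × Brick n,
            incl (L.brickSites p.1) (component p.1 (comm (F p.2) (G Y))) := hsum'.tsum_prod
      _ = ∑' Y, ∑' Z, ∑' X,
            incl (L.brickSites Z) (component Z (comm (F X) (G Y))) :=
          tsum_congr fun Y => (hY Y).tsum_prod
      _ = _ := by
          refine tsum_congr fun Y => tsum_congr fun Z => ?_
          rw [bracket_single_apply]
          exact ((inclCLM (L.brickSites Z)).map_tsum (hZY Z Y)).symm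
  have h2 : Summable fun Y => ∑' Z, incl (L.brickSites Z) (bracket F (Pi.single Y (G Y)) Z) := by
    refine hsum'.prod.congr fun Y => ?_
    rw [(hY Y).tsum_prod]
    refine tsum_congr fun Z => ?_
    rw [bracket_single_apply]
    exact ((inclCLM (L.brickSites Z)).map_tsum (hZY Z Y)).symm
  rw [average, h1, ψ.toFun.map_tsum h2]
  exact (tsum_congr h0).trans tsum_zero

end LatticeSystem

/-! ### Asymptotic directions of semilinear sets -/

open Filter Topology in
/-- A limit `v` of directions of points of a basic semilinear set `B` tending to infinity is a
recession direction of `B`: the constraints, rescaled to infinity, become homogeneous. -/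
theorem IsBasicSemilinear.add_smul_mem {n : ℕ} {B : Set (Fin n → ℝ)} (hB : IsBasicSemilinear B)
    {ι : Type*} {l : Filter ι} [l.NeBot] {y : ι → Fin n → ℝ} {c : ι → ℝ} {v : Fin n → ℝ}
    (hc : Tendsto c l (𝓝 0)) (hc0 : ∀ i, 0 ≤ c i) (hy : ∀ᶠ i in l, y i ∈ B)
    (hv : Tendsto (fun i => c i • y i) l (𝓝 v)) {x : Fin n → ℝ} (hx : x ∈ B) {t : ℝ}
    (ht : 0 ≤ t) : x + t • v ∈ B := by
  obtain ⟨H, K, rfl⟩ := hB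
  have hlim : ∀ h : (Fin n → ℝ) × ℝ,
      Tendsto (fun i => h.1 ⬝ᵥ (c i • y i)) l (𝓝 (h.1 ⬝ᵥ v)) := fun h =>
    ((Continuous.dotProduct continuous_const continuous_id).tendsto v).comp hv
  have hlim0 : ∀ h : (Fin n → ℝ) × ℝ, Tendsto (fun i => c i * h.2) l (𝓝 0) := fun h => by
    simpa using hc.mul_const h.2
  refine ⟨fun h hh => ?_, fun h hh => ?_⟩
  · have h0 : h.1 ⬝ᵥ v = 0 := by
      refine tendsto_nhds_unique ((hlim h).congr' ?_) (hlim0 h)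
      filter_upwards [hy] with i hi
      rw [dotProduct_smul, hi.1 h hh, smul_eq_mul]
    rw [dotProduct_add, dotProduct_smul, h0, hx.1 h hh]
    simp
  · have h0 : h.1 ⬝ᵥ v ≤ 0 := by
      refine le_of_tendsto_of_tendsto (hlim h) (hlim0 h) ?_
      filter_upwards [hy] with i hi
      rw [dotProduct_smul, smul_eq_mul]
      exact mul_le_mul_of_nonneg_left (hi.2 h hh).le (hc0 i)
    rw [dotProduct_add, dotProduct_smul, smul_eq_mul]
    have := hx.2 h hh
    nlinarith

open Filter Topology in
/-- If no direction lies at infinity in all the `U i`, then points of norm `R` have distance at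
least of order `R` from one of the `U i`. -/
theorem exists_norm_le_of_iInter_hat_eq_empty {n : ℕ} {I : Type*} (U : I → CS n) (s : Finset I)
    (hs : ¬ (⋂ i ∈ s, hat (U i)).Nonempty) :
    ∃ C : ℝ, 0 ≤ C ∧ ∀ (x : Fin n → ℝ) (d : ℝ), 0 ≤ d →
      (∀ i ∈ s, ∃ u ∈ (U i).carrier, dist u x ≤ d) → ‖x‖ ≤ C * (1 + d) := by
  by_contra! hcon
  have h1 : ∀ m : ℕ, ∃ (x : Fin n → ℝ) (d : ℝ), 0 ≤ d ∧
      (∀ i ∈ s, ∃ u ∈ (U i).carrier, dist u x ≤ d) ∧ ((m : ℝ) + 1) * (1 + d) < ‖x‖ := by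
    intro m
    obtain ⟨x, d, h1, h2, h3⟩ := hcon (m + 1) (by positivity)
    exact ⟨x, d, h1, h2, h3⟩
  choose x d hd hu hx using h1
  have hpos : ∀ m : ℕ, (m : ℝ) + 1 ≤ ‖x m‖ := fun m => by
    have h2 : (0 : ℝ) ≤ (m + 1) * d m := mul_nonneg (by positivity) (hd m)
    linarith [hx m]
  have hx0 : ∀ m, 0 < ‖x m‖ := fun m => lt_of_lt_of_le (by positivity) (hpos m)
  have hinv : Tendsto (fun m : ℕ => ((m : ℝ) + 1)⁻¹) atTop (𝓝 0) := by
    simpa using tendsto_one_div_add_atTop_nhds_zero_nat (𝕜 := ℝ)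
  have hc : Tendsto (fun m => ‖x m‖⁻¹) atTop (𝓝 0) :=
    squeeze_zero (fun m => by positivity)
      (fun m => inv_anti₀ (by positivity) (hpos m)) hinv
  -- a limit of the directions of the `x m` along an ultrafilter
  let 𝒢 : Ultrafilter ℕ := hyperfilter ℕ
  have h𝒢 : (𝒢 : Filter ℕ) ≤ atTop := Nat.hyperfilter_le_atTop
  obtain ⟨v, hv1, hv⟩ := (isCompact_sphere (0 : Fin n → ℝ) 1).ultrafilter_le_nhds'
    (𝒢.map fun m => ‖x m‖⁻¹ • x m) (Filter.mem_map.2 (Filter.univ_mem' fun m => by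
      simp [norm_smul, inv_mul_cancel₀ (hx0 m).ne']))
  have hvx : Tendsto (fun m => ‖x m‖⁻¹ • x m) 𝒢 (𝓝 v) := hv
  have hv0 : v ≠ 0 := by
    rintro rfl
    simp at hv1
  refine hs ⟨rayOfNeZero ℝ v hv0, Set.mem_iInter₂.2 fun i hi => ⟨v, hv0, rfl, ?_⟩⟩
  choose u huU hud using fun m => hu m i hi
  have hvu : Tendsto (fun m => ‖x m‖⁻¹ • u m) 𝒢 (𝓝 v) := by
    refine hvx.congr_dist (squeeze_zero (fun _ => dist_nonneg) (fun m => ?_) (hinv.mono_left h𝒢))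
    rw [dist_comm, dist_smul₀, norm_inv, norm_norm, inv_mul_le_iff₀ (hx0 m), ← div_eq_mul_inv,
      le_div_iff₀ (by positivity)]
    have : dist (u m) (x m) * (m + 1) ≤ d m * (m + 1) :=
      mul_le_mul_of_nonneg_right (hud m) (by positivity)
    nlinarith [hx m]
  obtain ⟨𝓑, hfin, hbasic, hU⟩ := (U i).semilinear
  obtain ⟨B, hB, hmem⟩ := (Ultrafilter.finite_sUnion_mem_iff hfin).1
    (show ⋃₀ 𝓑 ∈ 𝒢.map u from Filter.mem_map.2 (Filter.univ_mem' fun m => by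
      have := huU m
      rwa [hU] at this))
  have hmem' : ∀ᶠ m in (𝒢 : Filter ℕ), u m ∈ B := hmem
  obtain ⟨m, hm⟩ := hmem'.exists
  refine ⟨‖u m‖, norm_nonneg _, ?_⟩
  rintro _ ⟨t, ht, rfl⟩
  refine Metric.mem_cthickening_of_dist_le _ (u m + t • v) _ _ ?_ ?_
  · rw [hU]
    exact ⟨B, hB, (hbasic B hB).add_smul_mem (hc.mono_left h𝒢) (fun m => by positivity) hmem'
      hvu hm ht⟩
  · simp [dist_eq_norm]

theorem exists_index_norm_le {n : ℕ} {I : Type*} (U : I → CS n) (s : Finset I)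
    (hne : s.Nonempty) (hs : ¬ (⋂ i ∈ s, hat (U i)).Nonempty) :
    ∃ C : ℝ, 0 ≤ C ∧ ∀ (x : Fin n → ℝ) (δ : I → ℝ),
      (∀ i ∈ s, ∃ u ∈ (U i).carrier, dist u x ≤ δ i) → ∃ i ∈ s, ‖x‖ ≤ C * (1 + δ i) := by
  obtain ⟨C, hC0, hC⟩ := exists_norm_le_of_iInter_hat_eq_empty U s hs
  refine ⟨C, hC0, fun x δ h => ?_⟩
  obtain ⟨i, hi, hmax⟩ := s.exists_max_image δ hne
  obtain ⟨u, -, hu⟩ := h i hi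
  refine ⟨i, hi, hC x (δ i) (dist_nonneg.trans hu) fun j hj => ?_⟩
  obtain ⟨w, hw, hwx⟩ := h j hj
  exact ⟨w, hw, hwx.trans (hmax j hj)⟩

theorem setDist_le_of_subset_cthickening {n : ℕ} {U V : Set (Fin n → ℝ)} {r : ℝ} (hr : 0 ≤ r)
    (h : U ⊆ Metric.cthickening r V) (hU : U.Nonempty) {T : Set (Fin n → ℝ)} (hT : T.Nonempty) :
    setDist V T ≤ setDist U T + r := by
  refine le_of_forall_pos_le_add fun ε hε => ?_
  obtain ⟨u, hu, y, hy, huy⟩ := exists_dist_lt_setDist_add hU hT (half_pos hε)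
  have hu' := Metric.cthickening_subset_thickening' (δ₂ := r + ε / 2) (by linarith) (by linarith)
    V (h hu)
  obtain ⟨v, hv, huv⟩ := Metric.mem_thickening_iff.1 hu'
  have := setDist_le_dist hv hy
  linarith [dist_triangle_left v y u]

namespace LatticeSystem

variable {n : ℕ} {L : LatticeSystem n}

/-! ### Localization on families of sets -/

theorem dal_mono {U V : CS n} (h : U ≤ V) : L.Dal U.carrier ⊆ L.Dal V.carrier := by
  obtain ⟨r, hr, hUV⟩ := h
  refine fun F hF => ⟨hF.1, fun k => ?_⟩
  obtain ⟨C, hC0, hC⟩ := Dal.exists_bound hF k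
  refine ⟨(1 + r) ^ k * C, fun Y => ?_⟩
  have h1 := setDist_le_of_subset_cthickening hr hUV U.nonempty Y.nonempty
  have hw := Y.one_le_weight U.carrier
  have h2 : Y.weight V.carrier ≤ (1 + r) * Y.weight U.carrier := by
    have : r ≤ r * Y.weight U.carrier := le_mul_of_one_le_right hr hw
    unfold Brick.weight at this ⊢
    linarith
  have h3 := zero_le_one.trans (Y.one_le_weight V.carrier)
  change ‖F Y‖ * Y.weight V.carrier ^ k ≤ _
  calc ‖F Y‖ * Y.weight V.carrier ^ k ≤ ‖F Y‖ * ((1 + r) * Y.weight U.carrier) ^ k := by gcongr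
    _ = (1 + r) ^ k * (‖F Y‖ * Y.weight U.carrier ^ k) := by rw [mul_pow]; ring
    _ ≤ _ := by
      have := hC Y
      gcongr

/-- A family localized on each of finitely many sets without a common direction at infinity is
inner. -/
theorem mem_dal_zero {I : Type*} {U : I → CS n} {s : Finset I} (hne : s.Nonempty)
    (hs : ¬ (⋂ i ∈ s, hat (U i)).Nonempty) {F : L.Family}
    (hF : ∀ i ∈ s, F ∈ L.Dal (U i).carrier) : F ∈ L.Dal {0} := by
  obtain ⟨C, hC0, hC⟩ := exists_index_norm_le U s hne hs
  refine ⟨(hF _ hne.choose_spec).1, fun k => ?_⟩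
  have hD : ∀ i : I, ∃ D : ℝ, 0 ≤ D ∧ (i ∈ s → ∀ Y, ‖F Y‖ * Y.weight (U i).carrier ^ k ≤ D) := by
    intro i
    by_cases hi : i ∈ s
    · obtain ⟨D, hD0, hD⟩ := Dal.exists_bound (hF i hi) k
      exact ⟨D, hD0, fun _ => hD⟩
    · exact ⟨0, le_rfl, fun h => absurd h hi⟩
  choose D hD0 hD using hD
  refine ⟨(1 + 2 * C) ^ k * ∑ i ∈ s, D i, fun Y => ?_⟩
  obtain ⟨i, hi, hx⟩ := hC (fun i => (Y.fst i : ℝ))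
    (fun i => setDist (U i).carrier Y.toSet + Y.diam + 1) fun i _ => by
      obtain ⟨u, hu, h⟩ := Brick.exists_dist_lt_setDist (U i).nonempty Y.fst_mem one_pos
      exact ⟨u, hu, h.le⟩
  have hd := setDist_le_dist (Set.mem_singleton (0 : Fin n → ℝ)) Y.fst_mem
  rw [dist_zero_left] at hd
  have hdiam := Y.diam_nonneg
  have hsd := setDist_nonneg (U i).carrier Y.toSet
  have hw : Y.weight {0} ≤ (1 + 2 * C) * Y.weight (U i).carrier := by
    unfold Brick.weight
    have : 0 ≤ C * (Y.diam + setDist (U i).carrier Y.toSet) := by positivity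
    nlinarith
  have hw0 := zero_le_one.trans (Y.one_le_weight {0})
  change ‖F Y‖ * Y.weight {0} ^ k ≤ _
  calc ‖F Y‖ * Y.weight {0} ^ k ≤ ‖F Y‖ * ((1 + 2 * C) * Y.weight (U i).carrier) ^ k := by gcongr
    _ = (1 + 2 * C) ^ k * (‖F Y‖ * Y.weight (U i).carrier ^ k) := by rw [mul_pow]; ring
    _ ≤ _ := by
      refine mul_le_mul_of_nonneg_left ((hD i hi Y).trans ?_) (by positivity)
      exact Finset.single_le_sum (fun j _ => hD0 j) hi

/-- If `F` is localized on the `U i`, `i ∈ s`, and `G` on the `U i`, `i ∈ t`, where the `U i`,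
`i ∈ s ∪ t`, have no common direction at infinity, then the terms of `[F, G]` are small away from
the origin. -/
theorem exists_norm_mul_norm_le {I : Type*} [DecidableEq I] {U : I → CS n} {s t : Finset I}
    {V : Set (Fin n → ℝ)} (hne : (s ∪ t).Nonempty)
    (hs : ¬ (⋂ i ∈ s ∪ t, hat (U i)).Nonempty) {F G : L.Family}
    (hFV : F ∈ L.Dal V) (hGV : G ∈ L.Dal V)
    (hF : ∀ i ∈ s, F ∈ L.Dal (U i).carrier) (hG : ∀ i ∈ t, G ∈ L.Dal (U i).carrier) (m : ℕ) :
    ∃ C : ℝ, ∀ (X Y : Brick n), ∀ x ∈ X.toSet, x ∈ Y.toSet →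
      ‖F X‖ * ‖G Y‖ * ((1 + ‖x‖) * ((1 + X.diam) * (1 + Y.diam))) ^ m ≤ C := by
  obtain ⟨C, hC0, hC⟩ := exists_index_norm_le U (s ∪ t) hne hs
  let δ : Brick n → Brick n → I → ℝ := fun X Y i =>
    if i ∈ s then setDist (U i).carrier X.toSet + X.diam + 1
    else setDist (U i).carrier Y.toSet + Y.diam + 1
  have hD : ∀ i : I, ∃ D : ℝ, 0 ≤ D ∧ (i ∈ s ∪ t → ∀ (X Y : Brick n) (x : Fin n → ℝ),
      ‖x‖ ≤ C * (1 + δ X Y i) →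
      ‖F X‖ * ‖G Y‖ * ((1 + ‖x‖) * ((1 + X.diam) * (1 + Y.diam))) ^ m ≤ D) := by
    intro i
    by_cases his : i ∈ s
    · obtain ⟨D, hD0, hD⟩ := Dal.exists_bound (hF i his) (2 * m)
      obtain ⟨E, hE0, hE⟩ := Dal.exists_bound hGV m
      refine ⟨(1 + 2 * C) ^ m * (D * E), by positivity, fun _ X Y x hx => ?_⟩
      simp only [δ, his, if_true] at hx
      have hdX := X.diam_nonneg
      have hdY := Y.diam_nonneg
      have hsd := setDist_nonneg (U i).carrier X.toSet
      have hw : 1 + ‖x‖ ≤ (1 + 2 * C) * X.weight (U i).carrier := by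
        unfold Brick.weight
        have : 0 ≤ C * (X.diam + setDist (U i).carrier X.toSet) := by positivity
        nlinarith
      have h1 := X.one_add_diam_le_weight (U i).carrier
      have h2 := Y.one_add_diam_le_weight V
      have h3 : 0 ≤ X.weight (U i).carrier := by linarith
      have h4 : 0 ≤ Y.weight V := by linarith
      calc ‖F X‖ * ‖G Y‖ * ((1 + ‖x‖) * ((1 + X.diam) * (1 + Y.diam))) ^ m
          ≤ ‖F X‖ * ‖G Y‖ * (((1 + 2 * C) * X.weight (U i).carrier) *
              (X.weight (U i).carrier * Y.weight V)) ^ m := by gcongr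
        _ = (1 + 2 * C) ^ m * ((‖F X‖ * X.weight (U i).carrier ^ (2 * m)) *
              (‖G Y‖ * Y.weight V ^ m)) := by simp only [mul_pow, pow_mul']; ring
        _ ≤ _ := by
          have := hD X
          have := hE Y
          gcongr
    · by_cases hit : i ∈ t
      · obtain ⟨D, hD0, hD⟩ := Dal.exists_bound hFV m
        obtain ⟨E, hE0, hE⟩ := Dal.exists_bound (hG i hit) (2 * m)
        refine ⟨(1 + 2 * C) ^ m * (D * E), by positivity, fun _ X Y x hx => ?_⟩
        simp only [δ, his, if_false] at hx
        have hdX := X.diam_nonneg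
        have hdY := Y.diam_nonneg
        have hsd := setDist_nonneg (U i).carrier Y.toSet
        have hw : 1 + ‖x‖ ≤ (1 + 2 * C) * Y.weight (U i).carrier := by
          unfold Brick.weight
          have : 0 ≤ C * (Y.diam + setDist (U i).carrier Y.toSet) := by positivity
          nlinarith
        have h1 := Y.one_add_diam_le_weight (U i).carrier
        have h2 := X.one_add_diam_le_weight V
        have h3 : 0 ≤ Y.weight (U i).carrier := by linarith
        have h4 : 0 ≤ X.weight V := by linarith
        calc ‖F X‖ * ‖G Y‖ * ((1 + ‖x‖) * ((1 + X.diam) * (1 + Y.diam))) ^ m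
            ≤ ‖F X‖ * ‖G Y‖ * (((1 + 2 * C) * Y.weight (U i).carrier) *
                (X.weight V * Y.weight (U i).carrier)) ^ m := by gcongr
          _ = (1 + 2 * C) ^ m * ((‖F X‖ * X.weight V ^ m) *
                (‖G Y‖ * Y.weight (U i).carrier ^ (2 * m))) := by
            simp only [mul_pow, pow_mul']; ring
          _ ≤ _ := by
            have := hD X
            have := hE Y
            gcongr
      · exact ⟨0, le_rfl, fun h => absurd h (by simp [his, hit])⟩
  choose D hD0 hD using hD
  refine ⟨∑ i ∈ s ∪ t, D i, fun X Y x hX hY => ?_⟩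
  obtain ⟨i, hi, hx⟩ := hC x (δ X Y) fun i _ => by
    by_cases his : i ∈ s
    · obtain ⟨u, hu, h⟩ := Brick.exists_dist_lt_setDist (U i).nonempty hX one_pos
      exact ⟨u, hu, by simpa only [δ, his, if_true] using h.le⟩
    · obtain ⟨u, hu, h⟩ := Brick.exists_dist_lt_setDist (U i).nonempty hY one_pos
      exact ⟨u, hu, by simpa only [δ, his, if_false] using h.le⟩
  exact (hD i hi X Y x hx).trans (Finset.single_le_sum (fun j _ => hD0 j) hi)

end LatticeSystem

/-! ### Čech chains -/

section Cech

variable {I : Type*} [LinearOrder I]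

theorem posSign_insert {i a : I} {s : Finset I} (h : a ∉ s) :
    posSign i (insert a s) = (if a < i then -1 else 1) * posSign i s := by
  unfold posSign
  rw [Finset.filter_insert]
  split_ifs
  · rw [Finset.card_insert_of_notMem fun h' => h (Finset.mem_of_mem_filter _ h'), pow_succ']
  · rw [one_mul]

theorem posSign_mul_self (i : I) (s : Finset I) : posSign i s * posSign i s = 1 := by
  rw [posSign, ← mul_pow]
  simp

theorem abs_posSign (i : I) (s : Finset I) : |posSign i s| = 1 := by
  rw [posSign, abs_pow]
  simp

variable [Fintype I] {M : Type*} [AddCommGroup M] [Module ℝ M]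

/-- Contraction with `e_i ↦ 1` of `∑ e_s ⊗ h s`, for coefficients in any vector space. -/
def contraction (h : Finset I → M) (s : Finset I) : M :=
  ∑ i ∈ sᶜ, posSign i (insert i s) • h (insert i s)

/-- The coboundary of the full simplex on the vertex set `I`. -/
def simplexCoboundary (β : Finset I → ℝ) (t : Finset I) : ℝ :=
  ∑ i ∈ t, posSign i t * β (t.erase i)

theorem sum_smul_contraction (m : ℕ) (β : Finset I → ℝ) (h : Finset I → M) :
    ∑ s with s.card = m, β s • contraction h s =
      ∑ t with t.card = m + 1, simplexCoboundary β t • h t := by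
  simp only [contraction, simplexCoboundary, Finset.smul_sum, Finset.sum_smul]
  rw [Finset.sum_sigma', Finset.sum_sigma']
  refine Finset.sum_bij' (fun x _ => ⟨insert x.2 x.1, x.2⟩) (fun x _ => ⟨x.1.erase x.2, x.2⟩)
    ?_ ?_ ?_ ?_ ?_
  · rintro ⟨s, i⟩ hx
    simp only [Finset.mem_sigma, Finset.mem_filter, Finset.mem_univ, true_and,
      Finset.mem_compl] at hx ⊢
    exact ⟨by rw [Finset.card_insert_of_notMem hx.2, hx.1], Finset.mem_insert_self _ _⟩
  · rintro ⟨t, i⟩ hx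
    simp only [Finset.mem_sigma, Finset.mem_filter, Finset.mem_univ, true_and,
      Finset.mem_compl] at hx ⊢
    exact ⟨by rw [Finset.card_erase_of_mem hx.2, hx.1, Nat.add_sub_cancel],
      Finset.notMem_erase _ _⟩
  · rintro ⟨s, i⟩ hx
    simp only [Finset.mem_sigma, Finset.mem_compl] at hx
    simp [Finset.erase_insert hx.2]
  · rintro ⟨t, i⟩ hx
    simp only [Finset.mem_sigma] at hx
    simp [Finset.insert_erase hx.2]
  · rintro ⟨s, i⟩ hx
    simp only [Finset.mem_sigma, Finset.mem_compl] at hx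
    simp only [Finset.erase_insert hx.2]
    rw [smul_smul, mul_comm]

/-- Exterior multiplication by `e_i` is a contracting homotopy for the contraction. -/
theorem contraction_homotopy (i : I) (F : Finset I → M) (hF : ∀ s, contraction F s = 0)
    (s : Finset I) :
    contraction (fun t => if i ∈ t then posSign i t • F (t.erase i) else 0) s = F s := by
  by_cases hi : i ∈ s
  · obtain ⟨u, hu, rfl⟩ : ∃ u, i ∉ u ∧ insert i u = s :=
      ⟨s.erase i, Finset.notMem_erase i s, Finset.insert_erase hi⟩
    have h0 := hF u
    have hc : uᶜ = insert i (insert i u)ᶜ := by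
      ext j
      by_cases hj : j = i <;> simp [hj, hu]
    rw [contraction, hc, Finset.sum_insert (by simp), add_eq_zero_iff_eq_neg] at h0
    have hterm : ∀ j ∈ (insert i u)ᶜ,
        posSign j (insert j (insert i u)) • (if i ∈ insert j (insert i u) then
          posSign i (insert j (insert i u)) • F ((insert j (insert i u)).erase i) else 0) =
        -(posSign i (insert i u) • posSign j (insert j u) • F (insert j u)) := by
      intro j hj
      rw [Finset.mem_compl] at hj
      have hji : j ≠ i := fun h => hj (h ▸ Finset.mem_insert_self _ _)
      have hju : j ∉ u := fun h => hj (Finset.mem_insert_of_mem h)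
      have he : (insert j (insert i u)).erase i = insert j u := by
        rw [Finset.insert_comm, Finset.erase_insert]
        simp [hji.symm, hu]
      rw [if_pos (by simp), he, smul_smul, smul_smul, ← neg_smul]
      congr 1
      rw [posSign_insert hj, posSign_insert hj, posSign_insert hu, posSign_insert hu,
        posSign_insert hju]
      rcases lt_or_gt_of_ne hji with h | h
      · simp [h, h.not_gt]
        ring
      · simp [h, h.not_gt]
        ring
    rw [contraction, Finset.sum_congr rfl hterm, Finset.sum_neg_distrib, ← Finset.smul_sum,
      ← smul_neg, ← h0, smul_smul, posSign_mul_self, one_smul]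
  · rw [contraction, Finset.sum_eq_single i]
    · rw [if_pos (Finset.mem_insert_self _ _), Finset.erase_insert hi, smul_smul,
        posSign_mul_self, one_smul]
    · intro j _ hji
      rw [if_neg (by simp [hji.symm, hi]), smul_zero]
    · intro h
      exact absurd (Finset.mem_compl.2 hi) h

end Cech

open LatticeSystem

variable {n : ℕ} {L : LatticeSystem n} {W : CS n} {I : Type*} [Fintype I] [LinearOrder I]

namespace Cover

variable (𝔘 : Cover W I)

theorem coboundary_eq_simplexCoboundary {s : Finset I} (hs : 𝔘.InNerve s) (β : Finset I → ℝ) :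
    𝔘.coboundary β s = simplexCoboundary β s := if_pos hs

theorem exists_setDist_le : ∃ r : ℝ, 0 ≤ r ∧ ∀ Y : Brick n,
    ∃ i, setDist (𝔘.U i).carrier Y.toSet ≤ setDist W.carrier Y.toSet + r := by
  obtain ⟨r, hr, h⟩ := 𝔘.covers
  refine ⟨r + 1, by linarith, fun Y => ?_⟩
  obtain ⟨w, hw, y, hy, hwy⟩ :=
    exists_dist_lt_setDist_add W.nonempty Y.nonempty (ε := 1 / 2) (by norm_num)
  have hw' := Metric.cthickening_subset_thickening' (δ₂ := r + 1 / 2) (by linarith) (by linarith)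
    _ (h hw)
  obtain ⟨u, hu, hwu⟩ := Metric.mem_thickening_iff.1 hw'
  obtain ⟨i, hi⟩ := Set.mem_iUnion.1 hu
  refine ⟨i, ?_⟩
  have := setDist_le_dist hi hy
  linarith [dist_triangle_left u y w]

/-- Derivations localized on `W` and on each of the `U_i`, `i ∈ s`. A family localized on a meet of
these sets is of this kind, and using this space in place of `𝔇_al(⋀_{i ∈ s} U_i)` makes the
existence of meets irrelevant. -/
def localized (L : LatticeSystem n) (s : Finset I) : Submodule ℝ L.Family where
  carrier := {F | F ∈ L.Dal W.carrier ∧ ∀ i ∈ s, F ∈ L.Dal (𝔘.U i).carrier}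
  zero_mem' := ⟨(L.dalSubmodule _).zero_mem, fun _ _ => (L.dalSubmodule _).zero_mem⟩
  add_mem' := fun hF hG => ⟨(L.dalSubmodule _).add_mem hF.1 hG.1,
    fun i hi => (L.dalSubmodule _).add_mem (hF.2 i hi) (hG.2 i hi)⟩
  smul_mem' := fun r _ hF => ⟨(L.dalSubmodule _).smul_mem r hF.1,
    fun i hi => (L.dalSubmodule _).smul_mem r (hF.2 i hi)⟩

theorem derivations_subset_localized (ψ : L.State) (s : Finset I) :
    𝔘.derivations ψ s ⊆ 𝔘.localized L s := by
  rintro F ⟨M, hM, hF, -⟩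
  exact ⟨dal_mono (hM.1 (Set.mem_insert _ _)) hF, fun i hi =>
    dal_mono (hM.1 (Set.mem_insert_of_mem _ ⟨i, hi, rfl⟩)) hF⟩

theorem localized_le_dal_zero {s : Finset I} (hne : s.Nonempty) (hs : ¬ 𝔘.InNerve s) :
    𝔘.localized L s ≤ L.dalSubmodule {0} :=
  fun _ hF => mem_dal_zero hne (fun h => hs ⟨hne, h⟩) hF.2

/-- Pairing a cycle of localized derivations with a spherical cocycle gives an inner derivation: a
cycle is the contraction of a chain `h`, and `⟨∂h, β⟩ = ⟨h, δβ⟩` involves only the components of `h`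
outside the nerve. The chain `h` is `e_i ∧ F`, where at the brick `Y` the index `i` is chosen so
that `U_i` is close to `Y`. -/
theorem sum_smul_mem_dal_zero {p : ℕ} {β : Finset I → ℝ} (hβ : 𝔘.IsCocycle p β)
    {F : Finset I → L.Family} (hF : ∀ s, F s ∈ 𝔘.localized L s)
    (hcycle : ∀ s, contraction F s = 0) :
    ∑ s with s.card = p + 1, β s • F s ∈ L.dalSubmodule {0} := by
  obtain ⟨r, hr, h⟩ := 𝔘.exists_setDist_le
  choose ι hι using h
  let h : Finset I → L.Family := fun t Y =>
    if ι Y ∈ t then posSign (ι Y) t • F (t.erase (ι Y)) Y else 0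
  have hFh : ∀ s, F s = contraction h s := by
    intro s
    funext Y
    have hY : ∀ (H : Finset I → L.Family) (s : Finset I),
        contraction H s Y = contraction (fun t => H t Y) s := fun H s => by
      simp [contraction, Finset.sum_apply]
    rw [hY, ← contraction_homotopy (ι Y) (fun t => F t Y) (fun s => by rw [← hY, hcycle]; rfl) s]
  have hloc : ∀ t, ∀ j ∈ t, h t ∈ L.Dal (𝔘.U j).carrier := by
    intro t j hj
    refine ⟨fun Y => ?_, fun k => ?_⟩
    · simp only [h]
      split_ifs
      · exact (L.brickSubmodule Y).smul_mem _ ((hF _).1.1 Y)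
      · exact (L.brickSubmodule Y).zero_mem
    · have hD : ∀ i, ∃ D : ℝ, 0 ≤ D ∧ ∀ Y, ι Y = i →
          ‖F (t.erase i) Y‖ * Y.weight (𝔘.U j).carrier ^ k ≤ D := by
        intro i
        by_cases hij : i = j
        -- where `i` is the index chosen for `Y`, the decay away from `W` is decay away from `U_i`
        · subst hij
          obtain ⟨D, hD0, hD⟩ := Dal.exists_bound (hF (t.erase i)).1 k
          refine ⟨(1 + r) ^ k * D, by positivity, fun Y hY => ?_⟩
          have h1 := hι Y
          rw [hY] at h1
          have hw := Y.one_le_weight W.carrier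
          have h2 : Y.weight (𝔘.U i).carrier ≤ (1 + r) * Y.weight W.carrier := by
            have : r ≤ r * Y.weight W.carrier := le_mul_of_one_le_right hr hw
            unfold Brick.weight at this ⊢
            linarith
          have h3 := zero_le_one.trans (Y.one_le_weight (𝔘.U i).carrier)
          calc ‖F (t.erase i) Y‖ * Y.weight (𝔘.U i).carrier ^ k
              ≤ ‖F (t.erase i) Y‖ * ((1 + r) * Y.weight W.carrier) ^ k := by gcongr
            _ = (1 + r) ^ k * (‖F (t.erase i) Y‖ * Y.weight W.carrier ^ k) := by
                rw [mul_pow]; ring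
            _ ≤ _ := mul_le_mul_of_nonneg_left (hD Y) (by positivity)
        · obtain ⟨D, hD0, hD⟩ := Dal.exists_bound
            ((hF (t.erase i)).2 j (Finset.mem_erase.2 ⟨fun h => hij h.symm, hj⟩)) k
          exact ⟨D, hD0, fun Y _ => hD Y⟩
      choose D hD0 hD using hD
      refine ⟨∑ i, D i, fun Y => ?_⟩
      change ‖h t Y‖ * Y.weight (𝔘.U j).carrier ^ k ≤ _
      have hle : ‖h t Y‖ ≤ ‖F (t.erase (ι Y)) Y‖ := by
        simp only [h]
        split_ifs
        · rw [norm_smul, Real.norm_eq_abs, abs_posSign, one_mul]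
        · rw [norm_zero]
          exact norm_nonneg _
      have hw := zero_le_one.trans (Y.one_le_weight (𝔘.U j).carrier)
      exact (mul_le_mul_of_nonneg_right hle (pow_nonneg hw k)).trans
        ((hD _ Y rfl).trans (Finset.single_le_sum (fun i _ => hD0 i) (Finset.mem_univ _)))
  simp only [hFh]
  rw [sum_smul_contraction]
  refine Submodule.sum_mem _ fun t ht => ?_
  have hcard : t.card = p + 1 + 1 := (Finset.mem_filter.1 ht).2
  have hne : t.Nonempty := Finset.card_pos.1 (by omega)
  by_cases hN : 𝔘.InNerve t
  · rw [← 𝔘.coboundary_eq_simplexCoboundary hN, hβ.2, Pi.zero_apply, zero_smul]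
    exact Submodule.zero_mem _
  · exact Submodule.smul_mem _ _ (mem_dal_zero hne (fun h' => hN ⟨hne, h'⟩) (hloc t))

/-- The brackets of the elements of `𝔇_al^ψ(⋀_{i ∈ s₁} U_i)` and `𝔇_al^ψ(⋀_{i ∈ s₂} U_i)` with
`s₁ ∪ s₂ = s`. -/
def brackets (ψ : L.State) (s : Finset I) : Set L.Family :=
  {H | ∃ (s₁ s₂ : Finset I) (F G : L.Family), F ∈ 𝔘.derivations ψ s₁ ∧ G ∈ 𝔘.derivations ψ s₂ ∧
    s₁ ∪ s₂ = s ∧ H = bracket F G}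

theorem brackets_subset_localized (ψ : L.State) (s : Finset I) :
    𝔘.brackets ψ s ⊆ 𝔘.localized L s := by
  rintro _ ⟨s₁, s₂, F, G, hF, hG, rfl, rfl⟩
  replace hF := 𝔘.derivations_subset_localized ψ s₁ hF
  replace hG := 𝔘.derivations_subset_localized ψ s₂ hG
  refine ⟨bracket_mem_dal_left W.nonempty hF.1 hG.1, fun i hi => ?_⟩
  rcases Finset.mem_union.1 hi with hi | hi
  · exact bracket_mem_dal_left (𝔘.U i).nonempty (hF.2 i hi) hG.1
  · exact bracket_mem_dal_right (𝔘.U i).nonempty hF.1 (hG.2 i hi)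

end Cover

/-- The inner derivations with vanishing `ψ`-average. -/
def averageKer (ψ : L.State) : Submodule ℝ L.Family where
  carrier := {F | F ∈ L.Dal {0} ∧ average ψ F = 0}
  zero_mem' := ⟨(L.dalSubmodule _).zero_mem, by
    have h := average_smul ψ 0 (summable_norm_of_mem_dal (L.dalSubmodule {0}).zero_mem)
    rwa [zero_smul, zero_smul] at h⟩
  add_mem' := fun hF hG => ⟨(L.dalSubmodule _).add_mem hF.1 hG.1, by
    rw [average_add ψ (summable_norm_of_mem_dal hF.1) (summable_norm_of_mem_dal hG.1), hF.2, hG.2,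
      add_zero]⟩
  smul_mem' := fun r F hF => ⟨(L.dalSubmodule _).smul_mem r hF.1, by
    rw [average_smul ψ r (summable_norm_of_mem_dal hF.1), hF.2, smul_zero]⟩

/-- Outside the nerve the brackets are inner, and their averages vanish although `F` and `G` need
not be inner: `ψ([F, G])` is the sum of the numbers `ψ([F, G^Y])`, and every `G^Y` is inner. -/
theorem Cover.brackets_subset_averageKer (𝔘 : Cover W I) (ψ : L.State) {s : Finset I}
    (hne : s.Nonempty) (hs : ¬ 𝔘.InNerve s) : 𝔘.brackets ψ s ⊆ averageKer ψ := by
  intro H hH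
  refine ⟨𝔘.localized_le_dal_zero hne hs (𝔘.brackets_subset_localized ψ s hH), ?_⟩
  obtain ⟨s₁, s₂, F, G, hF, hG, rfl, rfl⟩ := hH
  have hF' := 𝔘.derivations_subset_localized ψ s₁ hF
  have hG' := 𝔘.derivations_subset_localized ψ s₂ hG
  refine average_bracket_eq_zero ψ (summable_norm_component_comm fun m =>
    exists_norm_mul_norm_le hne (fun h => hs ⟨hne, h⟩) hF'.1 hG'.1 hF'.2 hG'.2 m) fun Y => ?_
  obtain ⟨M, -, -, hψ⟩ := hF
  exact hψ _ (single_mem_dal _ (hG'.1.1 Y))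

/-! ### Tensor products with the graded components -/

section Tensor

variable {V : Type*} [AddCommGroup V] [Module ℝ V]

theorem tensorSpan_mono {𝔛 𝔜 : Set L.Family} (h : 𝔛 ⊆ 𝔜) :
    tensorSpan 𝔛 V ≤ tensorSpan 𝔜 V :=
  Submodule.span_mono fun _ ⟨F, hF, a, ha⟩ => ⟨F, h hF, a, ha⟩

/-- The contraction of the second factor with a linear form. -/
def tensorCoord (L : LatticeSystem n) (φ : V →ₗ[ℝ] ℝ) : L.Family ⊗[ℝ] V →ₗ[ℝ] L.Family :=
  (TensorProduct.rid ℝ L.Family).toLinearMap ∘ₗ LinearMap.lTensor L.Family φ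

theorem tensorCoord_tmul (φ : V →ₗ[ℝ] ℝ) (F : L.Family) (a : V) :
    tensorCoord L φ (F ⊗ₜ[ℝ] a) = φ a • F := by
  simp [tensorCoord]

theorem tensorCoord_mem {P : Submodule ℝ L.Family} (φ : V →ₗ[ℝ] ℝ) {x : L.Family ⊗[ℝ] V}
    (hx : x ∈ tensorSpan (P : Set L.Family) V) : tensorCoord L φ x ∈ P := by
  have : tensorSpan (P : Set L.Family) V ≤ P.comap (tensorCoord L φ) := by
    refine Submodule.span_le.2 ?_
    rintro _ ⟨F, hF, a, rfl⟩
    rw [SetLike.mem_coe, Submodule.mem_comap, tensorCoord_tmul]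
    exact P.smul_mem _ hF
  exact this hx

variable [FiniteDimensional ℝ V]

theorem sum_tensorCoord_tmul (x : L.Family ⊗[ℝ] V) :
    ∑ i, tensorCoord L ((Module.finBasis ℝ V).coord i) x ⊗ₜ[ℝ] Module.finBasis ℝ V i = x := by
  induction x with
  | zero => simp
  | add x y hx hy =>
    simp only [map_add, TensorProduct.add_tmul, Finset.sum_add_distrib, hx, hy]
  | tmul F a =>
    simp only [tensorCoord_tmul, TensorProduct.smul_tmul, ← TensorProduct.tmul_sum,
      Module.Basis.coord_apply, Module.Basis.sum_repr]

theorem averageTensor_eq_sum (ψ : L.State) (x : L.Family ⊗[ℝ] V) :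
    averageTensor ψ x = ∑ i, average ψ (tensorCoord L ((Module.finBasis ℝ V).coord i) x) ⊗ₜ[ℝ]
      Module.finBasis ℝ V i := rfl

theorem averageTensor_eq_of_sub_mem (ψ : L.State) {x y : L.Family ⊗[ℝ] V}
    (hy : y ∈ tensorSpan (L.Dal {0}) V) (hxy : x - y ∈ tensorSpan (averageKer ψ : Set L.Family) V) :
    averageTensor ψ x = averageTensor ψ y := by
  rw [averageTensor_eq_sum, averageTensor_eq_sum]
  refine Finset.sum_congr rfl fun i _ => ?_
  congr 1
  have h1 := tensorCoord_mem ((Module.finBasis ℝ V).coord i) hxy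
  have h2 := tensorCoord_mem (P := L.dalSubmodule {0}) ((Module.finBasis ℝ V).coord i) hy
  have h3 := average_add ψ (summable_norm_of_mem_dal h1.1) (summable_norm_of_mem_dal h2)
  rwa [← map_add, sub_add_cancel, h1.2, zero_add] at h3

end Tensor

section Chains

variable {A : ℤ → Type*} [∀ k, AddCommGroup (A k)] [∀ k, Module ℝ (A k)]

theorem boundary_apply (f : Chain L A I) (s : Finset I) (k : ℤ) :
    boundary f s k = contraction (fun t => f t k) s := rfl

theorem chain_apply_mem_tensorSpan {ψ : L.State} {𝔸 : SuperAlgebra A} {𝔘 : Cover W I}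
    {f : Chain L A I} (hf : f ∈ commutatorDGLA ψ 𝔸 𝔘) (s : Finset I) (k : ℤ) :
    f s k ∈ tensorSpan (𝔘.brackets ψ s) (A k) := by
  have hle : Submodule.span ℝ (commutators ψ 𝔸 𝔘 (s.card + k)) ≤
      (tensorSpan (𝔘.brackets ψ s) (A k)).comap
        (LinearMap.proj k ∘ₗ
          LinearMap.proj (φ := fun _ : Finset I => ∀ k, L.Family ⊗[ℝ] A k) s) := by
    refine Submodule.span_le.2 ?_
    rintro _ ⟨s₁, s₂, k₁, k₂, F, G, a, b, hF, hG, -, rfl⟩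
    change chainBracket 𝔸 s₁ F a s₂ G b s k ∈ tensorSpan (𝔘.brackets ψ s) (A k)
    unfold chainBracket singleChain
    split_ifs
    · by_cases hs : s = s₁ ∪ s₂
      · subst hs
        rw [Pi.single_eq_same]
        by_cases hk : k = k₁ + k₂
        · subst hk
          rw [Pi.single_eq_same]
          have hmem : bracket F G ⊗ₜ[ℝ] 𝔸.mul k₁ k₂ a b ∈
              tensorSpan (𝔘.brackets ψ (s₁ ∪ s₂)) (A (k₁ + k₂)) :=
            Submodule.subset_span ⟨_, ⟨s₁, s₂, F, G, hF, hG, rfl, rfl⟩, _, rfl⟩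
          exact zsmul_mem (Submodule.smul_mem _ _ hmem) _
        · rw [Pi.single_eq_of_ne hk]
          exact Submodule.zero_mem _
      · rw [Pi.single_eq_of_ne hs]
        exact Submodule.zero_mem _
    · exact Submodule.zero_mem _
  have h := hle (hf (s.card + k))
  rw [Submodule.mem_comap] at h
  change degreePart (s.card + k) f s k ∈ tensorSpan (𝔘.brackets ψ s) (A k) at h
  rwa [degreePart, if_pos rfl] at h

theorem chain_apply_mem_tensorSpan_averageKer {ψ : L.State} {𝔸 : SuperAlgebra A} {𝔘 : Cover W I}
    {f : Chain L A I} (hf : f ∈ commutatorDGLA ψ 𝔸 𝔘) {s : Finset I} (hne : s.Nonempty)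
    (hs : ¬ 𝔘.InNerve s) (k : ℤ) :
    f s k ∈ tensorSpan (averageKer ψ : Set L.Family) (A k) :=
  tensorSpan_mono (𝔘.brackets_subset_averageKer ψ hne hs) (chain_apply_mem_tensorSpan hf s k)

/-- `⟨∂g, β⟩ = ⟨g, δβ⟩` involves only the components of `g` outside the nerve. -/
theorem evaluation_boundary_mem {ψ : L.State} {𝔸 : SuperAlgebra A} {𝔘 : Cover W I}
    {g : Chain L A I} (hg : g ∈ commutatorDGLA ψ 𝔸 𝔘) {p : ℕ} {β : Finset I → ℝ}
    (hβ : 𝔘.IsCocycle p β) (k : ℤ) :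
    evaluation p (boundary g) β k ∈ tensorSpan (averageKer ψ : Set L.Family) (A k) := by
  simp only [evaluation, boundary_apply]
  rw [sum_smul_contraction]
  refine Submodule.sum_mem _ fun t ht => ?_
  have hcard : t.card = p + 1 + 1 := (Finset.mem_filter.1 ht).2
  have hne : t.Nonempty := Finset.card_pos.1 (by omega)
  by_cases hN : 𝔘.InNerve t
  · rw [← 𝔘.coboundary_eq_simplexCoboundary hN, hβ.2, Pi.zero_apply, zero_smul]
    exact Submodule.zero_mem _
  · exact Submodule.smul_mem _ _ (chain_apply_mem_tensorSpan_averageKer hg hne hN k)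

/-- For a cycle `f`, the coboundary of `b` in the full simplex pairs to zero with `f`, and it
differs from the coboundary in the nerve only outside the nerve. -/
theorem evaluation_coboundary_mem {ψ : L.State} {𝔸 : SuperAlgebra A} {𝔘 : Cover W I}
    {f : Chain L A I} (hf : f ∈ commutatorDGLA ψ 𝔸 𝔘) (hcycle : boundary f = 0) (p : ℕ)
    (b : Finset I → ℝ) (k : ℤ) :
    evaluation p f (𝔘.coboundary b) k ∈ tensorSpan (averageKer ψ : Set L.Family) (A k) := by
  have h0 : ∑ s with s.card = p + 1, simplexCoboundary b s • f s k = 0 := by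
    rw [← sum_smul_contraction p b fun t => f t k]
    refine Finset.sum_eq_zero fun s _ => ?_
    rw [← boundary_apply, hcycle, Pi.zero_apply, Pi.zero_apply, smul_zero]
  rw [evaluation, ← sub_zero (Finset.sum _ _), ← h0, ← Finset.sum_sub_distrib]
  refine Submodule.sum_mem _ fun s hs => ?_
  have hcard : s.card = p + 1 := (Finset.mem_filter.1 hs).2
  have hne : s.Nonempty := Finset.card_pos.1 (by omega)
  rw [← sub_smul (𝔘.coboundary b s) (simplexCoboundary b s) (f s k)]
  by_cases hN : 𝔘.InNerve s
  · rw [𝔘.coboundary_eq_simplexCoboundary hN, sub_self, zero_smul]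
    exact Submodule.zero_mem _
  · exact Submodule.smul_mem _ _ (chain_apply_mem_tensorSpan_averageKer hf hne hN k)

variable [∀ k, FiniteDimensional ℝ (A k)]

theorem evaluation_mem_tensorSpan_dal_zero {ψ : L.State} {𝔸 : SuperAlgebra A} {𝔘 : Cover W I}
    {f : Chain L A I} (hf : f ∈ commutatorDGLA ψ 𝔸 𝔘) (hcycle : boundary f = 0) {p : ℕ}
    {β : Finset I → ℝ} (hβ : 𝔘.IsCocycle p β) (k : ℤ) :
    evaluation p f β k ∈ tensorSpan (L.Dal {0}) (A k) := by
  rw [← sum_tensorCoord_tmul (evaluation p f β k)]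
  refine Submodule.sum_mem _ fun i _ => Submodule.subset_span ⟨_, ?_, _, rfl⟩
  rw [evaluation, map_sum]
  simp only [map_smul]
  refine 𝔘.sum_smul_mem_dal_zero hβ (fun s => ?_) fun s => ?_
  · exact tensorCoord_mem _ (tensorSpan_mono (𝔘.brackets_subset_localized ψ s)
      (chain_apply_mem_tensorSpan hf s k))
  · have h := boundary_apply f s k
    rw [hcycle] at h
    have h' := congrArg (tensorCoord L ((Module.finBasis ℝ (A k)).coord i)) h.symm
    simpa only [contraction, map_sum, map_smul, Pi.zero_apply, map_zero] using h'

end Chains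

end LatticeGauge

end

theorem mainTheorem4 {n : ℕ} (L : LatticeGauge.LatticeSystem n) (ψ : L.State)
    {A : ℤ → Type*} [∀ k, AddCommGroup (A k)] [∀ k, Module ℝ (A k)]
    [∀ k, FiniteDimensional ℝ (A k)] (𝔸 : LatticeGauge.SuperAlgebra A)
    (W : LatticeGauge.CS n) {I : Type*} [Fintype I] [LinearOrder I]
    (𝔘 : LatticeGauge.Cover W I) (p : ℕ)
    (f f' : LatticeGauge.Chain L A I)
    (hf : f ∈ LatticeGauge.commutatorDGLA ψ 𝔸 𝔘) (hf' : f' ∈ LatticeGauge.commutatorDGLA ψ 𝔸 𝔘)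
    (hcycle : LatticeGauge.boundary f = 0) (hcycle' : LatticeGauge.boundary f' = 0)
    (hhom : ∃ g ∈ LatticeGauge.commutatorDGLA ψ 𝔸 𝔘, f - f' = LatticeGauge.boundary g)
    (β β' : Finset I → ℝ) (hβ : 𝔘.IsCocycle p β) (hβ' : 𝔘.IsCocycle p β')
    (hcoh : 𝔘.Cohomologous p β β') :
    (∀ k, LatticeGauge.evaluation p f β k ∈ LatticeGauge.tensorSpan (L.Dal {0}) (A k)) ∧
    ∀ k, LatticeGauge.averageTensor ψ (LatticeGauge.evaluation p f β k) =
      LatticeGauge.averageTensor ψ (LatticeGauge.evaluation p f' β' k) := by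
  refine ⟨fun k => LatticeGauge.evaluation_mem_tensorSpan_dal_zero hf hcycle hβ k, fun k => ?_⟩
  obtain ⟨g, hg, hfg⟩ := hhom
  obtain ⟨b, -, hb⟩ := hcoh
  refine LatticeGauge.averageTensor_eq_of_sub_mem ψ
    (LatticeGauge.evaluation_mem_tensorSpan_dal_zero hf' hcycle' hβ' k) ?_
  have h : LatticeGauge.evaluation p f β k - LatticeGauge.evaluation p f' β' k =
      LatticeGauge.evaluation p f (𝔘.coboundary b) k +
        LatticeGauge.evaluation p (LatticeGauge.boundary g) β' k := by
    rw [← hb, ← hfg]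
    simp only [LatticeGauge.evaluation, ← Finset.sum_sub_distrib, ← Finset.sum_add_distrib,
      Pi.sub_apply]
    refine Finset.sum_congr rfl fun s _ => ?_
    rw [sub_smul (β s) (β' s) (f s k), smul_sub (β' s) (f s k) (f' s k)]
    abel
  rw [h]
  exact Submodule.add_mem _ (LatticeGauge.evaluation_coboundary_mem hf hcycle p b k)
    (LatticeGauge.evaluation_boundary_mem hg hβ' k)
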